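/- **Proposition (sparse operator bound).** Let $d, n \ge 1$ be integers. There is a constant $C = C(n,d)$ such that the following holds. Let $\mathcal{D}$ be a dyadic grid in $\mathbb{R}^d$, that is, a family of half-open cubes (with sides parallel to the axes) of side lengths $2^k$, $k \in \mathbb{Z}$, any two of which are nested or disjoint, such that for each $k \in \mathbb{Z}$ the cubes of side length $2^k$ in $\mathcal{D}$ partition $\mathbb{R}^d$. Let $\mathcal{G} \subseteq \mathcal{D}$ be sparse, in the sense that $$\sum_{J \in \mathrm{ch}_{\mathcal{G}}(I)} |J| \le \tfrac12 |I| \qquad \text{for every } I \in \mathcal{G},$$ where $\mathrm{ch}_{\mathcal{G}}(I)$ is the set of maximal elements of $\{J \in \mathcal{G} : J \subsetneq I\}$. Let $W$ be a matrix $A_2$ weight, that is, a measurable function from $\mathbb{R}^d$ to the $n\times n$ complex matrices that is positive definite almost everywhere and satisfies $$[W]_{A_2} := \sup_{I} \frac{1}{|I|}\int_I \frac{1}{|I|}\int_I \bigl\| W^{1/2}(x)\, W^{-1/2}(t) \bigr\|^2 \, dt\, dx < \infty,$$ where the supremum is over all cubes $I \subset \mathbb{R}^d$ (with sides parallel to the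 axes) and $\|\cdot\|$ is the operator norm on $\mathbb{C}^n$ with its Euclidean norm. Let $L^2(W)$ be the space of measurable $\vec f : \mathbb{R}^d \to \mathbb{C}^n$ with $\|\vec f\|_{L^2(W)}^2 = \int_{\mathbb{R}^d} |W^{1/2}(x) \vec f(x)|^2\, dx < \infty$. Then for every $\vec f \in L^2(W)$ the averages $m_I \vec f = \frac{1}{|I|}\int_I \vec f$, $I \in \mathcal{G}$, are well defined (that is, $\vec f$ is integrable on $I$), the series $$S \vec f = \sum_{I \in \mathcal{G}} (m_I \vec f)\, \chi_I$$ converges absolutely almost everywhere, $S \vec f \in L^2(W)$, and the sparse operator $S$ satisfies $$\|S\|_{L^2(W) \to L^2(W)} \le C\, [W]_{A_2}^{3/2}.$$ -/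

import Mathlib

open MeasureTheory
open scoped ENNReal NNReal ComplexOrder

noncomputable section

/-- The half-open cube `∏ᵢ [aᵢ, aᵢ + ℓ)` in `ℝᵈ`. -/
def cube {d : ℕ} (a : Fin d → ℝ) (ℓ : ℝ) : Set (Fin d → ℝ) :=
  {x | ∀ i, a i ≤ x i ∧ x i < a i + ℓ}

/-- A dyadic grid in `ℝᵈ`: a family of half-open cubes with side lengths `2 ^ k`, `k ∈ ℤ`, any two
of which are nested or disjoint, and such that for every `k` the cubes of side length `2 ^ k` in the
family partition `ℝᵈ`. -/
structure IsDyadicGrid {d : ℕ} (D : Set (Set (Fin d → ℝ))) : Prop where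
  eq_cube : ∀ I ∈ D, ∃ (k : ℤ) (a : Fin d → ℝ), I = cube a ((2 : ℝ) ^ k)
  nested : ∀ I ∈ D, ∀ J ∈ D, I ⊆ J ∨ J ⊆ I ∨ Disjoint I J
  partition : ∀ (k : ℤ) (x : Fin d → ℝ),
    ∃! I, I ∈ D ∧ x ∈ I ∧ ∃ a : Fin d → ℝ, I = cube a ((2 : ℝ) ^ k)

/-- The `G`-children of `I`: the maximal elements of `G` strictly contained in `I`. -/
def childrenIn {d : ℕ} (G : Set (Set (Fin d → ℝ))) (I : Set (Fin d → ℝ)) :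
    Set (Set (Fin d → ℝ)) :=
  {J | Maximal (fun K => K ∈ G ∧ K ⊂ I) J}

/-- `G` is sparse: the total measure of the `G`-children of each `I ∈ G` is at most `|I| / 2`. -/
def IsSparse {d : ℕ} (G : Set (Set (Fin d → ℝ))) : Prop :=
  ∀ I ∈ G, ∑' J : childrenIn G I, volume (J : Set (Fin d → ℝ)) ≤ volume I / 2

/-- The sparse operator `S f = ∑_{I ∈ G} (m_I f) χ_I`. -/
def sparseOp {d n : ℕ} (G : Set (Set (Fin d → ℝ)))
    (f : (Fin d → ℝ) → EuclideanSpace ℂ (Fin n)) : (Fin d → ℝ) → EuclideanSpace ℂ (Fin n) :=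
  fun x => ∑' I : G, (I : Set (Fin d → ℝ)).indicator (fun _ => ⨍ y in (I : Set (Fin d → ℝ)), f y) x

open scoped MatrixOrder Matrix.Norms.L2Operator in
/-- The positive semidefinite square root of a positive semidefinite matrix. -/
def matrixSqrt {n : ℕ} (A : Matrix (Fin n) (Fin n) ℂ) : Matrix (Fin n) (Fin n) ℂ :=
  CFC.sqrt A

/-- The operator norm of a matrix acting on `ℂⁿ` with its Euclidean norm, in `[0, ∞]`. -/
def matrixOpNorm {n : ℕ} (A : Matrix (Fin n) (Fin n) ℂ) : ℝ≥0∞ :=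
  ‖Matrix.toEuclideanCLM (n := Fin n) (𝕜 := ℂ) A‖ₑ

/-- The matrix `A₂` characteristic
`sup_I 1/|I| ∫_I 1/|I| ∫_I ‖W(x)^{1/2} W(t)^{-1/2}‖² dt dx` over all cubes `I`. -/
def a2Char {d n : ℕ} (W : (Fin d → ℝ) → Matrix (Fin n) (Fin n) ℂ) : ℝ≥0∞ :=
  ⨆ (a : Fin d → ℝ) (ℓ : ℝ) (_ : 0 < ℓ),
    ⨍⁻ x in cube a ℓ, ⨍⁻ t in cube a ℓ,
      matrixOpNorm (matrixSqrt (W x) * (matrixSqrt (W t))⁻¹) ^ 2 ∂volume ∂volume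

/-- A matrix `A₂` weight: measurable, positive definite almost everywhere, with finite `A₂`
characteristic. -/
structure IsA2Weight {d n : ℕ} (W : (Fin d → ℝ) → Matrix (Fin n) (Fin n) ℂ) : Prop where
  aemeasurable : ∀ i j, AEMeasurable (fun x => W x i j) volume
  posDef : ∀ᵐ x, (W x).PosDef
  a2Char_lt_top : a2Char W < ∞

/-- The norm `‖f‖_{L²(W)} = (∫ |W(x)^{1/2} f(x)|² dx)^{1/2}`, in `[0, ∞]`. -/
def weightedNorm {d n : ℕ} (W : (Fin d → ℝ) → Matrix (Fin n) (Fin n) ℂ)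
    (f : (Fin d → ℝ) → EuclideanSpace ℂ (Fin n)) : ℝ≥0∞ :=
  (∫⁻ x, ‖Matrix.toEuclideanCLM (n := Fin n) (𝕜 := ℂ) (matrixSqrt (W x)) (f x)‖ₑ ^ 2) ^ (1 / 2 : ℝ)

/-- Membership in `L²(W)`. -/
def MemL2 {d n : ℕ} (W : (Fin d → ℝ) → Matrix (Fin n) (Fin n) ℂ)
    (f : (Fin d → ℝ) → EuclideanSpace ℂ (Fin n)) : Prop :=
  AEStronglyMeasurable f volume ∧ weightedNorm W f < ∞

/-- The operator norm `‖T‖_{L²(W) → L²(W)}` (equal to `∞` if `T` is not bounded). -/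
def weightedOpNorm {d n : ℕ} (W : (Fin d → ℝ) → Matrix (Fin n) (Fin n) ℂ)
    (T : ((Fin d → ℝ) → EuclideanSpace ℂ (Fin n)) → ((Fin d → ℝ) → EuclideanSpace ℂ (Fin n))) :
    ℝ≥0∞ :=
  sInf {c | ∀ f, MemL2 W f → weightedNorm W (T f) ≤ c * weightedNorm W f}

end

/-! Put `U = W^{1/2}` and `V = W^{-1/2}`. Replacing `f` by `U f` turns the claim into an unweighted
`L²` bound for `g ↦ U · S (V g)`, whose bilinear form is `∑ |I|⁻¹ ⟨∫_I V f, ∫_I U g⟩`. All that is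
used of the weight is that the double integral of `‖U x * V t‖²` over `I × I` is at most `A |I|²`,
with `A` the `A₂` characteristic.

On each `I` choose vectors `w_I`, `u_I` such that `V w_I` and `U u_I` are the orthogonal projections
in `L²(I)` of `f` and `g` onto the functions `V v`, respectively `U v`, with `v` constant. Then `∫_I
V f = ∫_I V² w_I`, and similarly for `g`, so two applications of Cauchy-Schwarz bound the `I`-th
term by `A^{1/2} ‖V w_I‖ ‖U u_I‖`, with norms in `L²(I)` (`enorm_inner_integral_sq_le`).

It remains to show `∑ ‖U u_I‖² ≤ 16 A ‖g‖²`, and the same for `V`, `w_I`, `f`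
(`exists_sum_lintegral_le`). The `A₂` bound gives `∫_I |U v|² ≤ 4 A ∫_E |U v|²` for the exceptional
part `E` of `I`, which has at least half the measure (`lintegral_enorm_apply_sq_le`). The sum over
exceptional parts is at most `4 ‖g‖²` by a Doob-type inequality for the projections
(`sum_setIntegral_exceptionalPart_norm_sq_le`). Altogether the squared form is at most `A (16 A)²
‖f‖² ‖g‖²`, so `C = 16`.

Finite families come first. Testing the form on `V e` restricted to a cube `Q` gives absolute
convergence over the members containing `Q`, Borel-Cantelli handles the smaller members, and Fatou
carries the bound to the full sum. -/

/-! ### Exceptional parts and children in nested families -/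

/-- The part of `I` not covered by the members of `G` strictly contained in `I`. -/
def exceptionalPart {X : Type*} (G : Set (Set X)) (I : Set X) : Set X :=
  I \ ⋃₀ {J | J ∈ G ∧ J ⊂ I}

theorem exceptionalPart_subset {X : Type*} (G : Set (Set X)) (I : Set X) :
    exceptionalPart G I ⊆ I :=
  Set.sdiff_subset

/-- This monotonicity lets sparseness pass to subfamilies, whose children may be quite different
sets. -/
theorem exceptionalPart_anti {X : Type*} {G G' : Set (Set X)} (h : G ⊆ G') (I : Set X) :
    exceptionalPart G' I ⊆ exceptionalPart G I :=
  Set.sdiff_subset_sdiff_right (Set.sUnion_subset_sUnion fun _ hJ => ⟨h hJ.1, hJ.2⟩)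

theorem measurableSet_exceptionalPart {X : Type*} [MeasurableSpace X] {G : Set (Set X)}
    (hG : G.Countable) (hm : ∀ I ∈ G, MeasurableSet I) {I : Set X} (hI : MeasurableSet I) :
    MeasurableSet (exceptionalPart G I) :=
  hI.diff (MeasurableSet.sUnion (hG.mono fun _ h => h.1) fun _ h => hm _ h.1)

theorem disjoint_exceptionalPart {X : Type*} {G : Set (Set X)} {I J : Set X}
    (hI : I ∈ G) (hJ : J ∈ G) (hIJ : I ≠ J) (h : I ⊆ J ∨ J ⊆ I ∨ Disjoint I J) :
    Disjoint (exceptionalPart G I) (exceptionalPart G J) := by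
  rw [Set.disjoint_left]
  rintro x ⟨hxI, hxI'⟩ ⟨hxJ, hxJ'⟩
  rcases h with h | h | h
  · exact hxJ' ⟨I, ⟨hI, h.ssubset_of_ne hIJ⟩, hxI⟩
  · exact hxI' ⟨J, ⟨hJ, h.ssubset_of_ne hIJ.symm⟩, hxJ⟩
  · exact Set.disjoint_left.1 h hxI hxJ

open Classical in
/-- The maximal members of `F` strictly contained in `I`. -/
noncomputable def finsetChildren {X : Type*} (F : Finset (Set X)) (I : Set X) : Finset (Set X) :=
  F.filter fun J => Maximal (fun K => K ∈ F ∧ K ⊂ I) J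

section Children

variable {X : Type*} {F : Finset (Set X)}

theorem mem_finsetChildren {I J : Set X} :
    J ∈ finsetChildren F I ↔ Maximal (fun K => K ∈ F ∧ K ⊂ I) J := by
  simp only [finsetChildren, Finset.mem_filter, and_iff_right_iff_imp]
  exact fun h => h.prop.1

theorem disjoint_of_maximal {P : Set X → Prop} {J K : Set X}
    (h : J ⊆ K ∨ K ⊆ J ∨ Disjoint J K) (hJ : Maximal P J) (hK : Maximal P K) (hJK : J ≠ K) :
    Disjoint J K := by
  rcases h with h | h | h
  · exact absurd (h.antisymm (hJ.le_of_ge hK.prop h)) hJK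
  · exact absurd (h.antisymm (hK.le_of_ge hJ.prop h)).symm hJK
  · exact h

theorem sUnion_eq_biUnion_finsetChildren (F : Finset (Set X)) (I : Set X) :
    ⋃₀ {J | J ∈ (F : Set (Set X)) ∧ J ⊂ I} = ⋃ J ∈ finsetChildren F I, J := by
  classical
  ext x
  simp only [Set.mem_sUnion, Set.mem_ofPred_eq, Finset.mem_coe, Set.mem_iUnion, exists_prop,
    mem_finsetChildren]
  constructor
  · rintro ⟨J, hJ, hx⟩
    obtain ⟨K, hJK, hK⟩ := (F.filter (· ⊂ I)).exists_le_maximal (a := J) (by simpa using hJ)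
    exact ⟨K, by simpa using hK, hJK hx⟩
  · rintro ⟨J, hJ, hx⟩
    exact ⟨J, hJ.prop, hx⟩

/-- No `J` is a child of two members: both would contain the nonempty `J`, hence be nested, and the
smaller one would contradict maximality of `J` in the larger. -/
theorem sum_sum_finsetChildren_le
    (hne : ∀ I ∈ F, I.Nonempty)
    (hnest : ∀ I ∈ F, ∀ J ∈ F, I ⊆ J ∨ J ⊆ I ∨ Disjoint I J) {q : Set X → ℝ}
    (hq : ∀ I, 0 ≤ q I) :
    ∑ I ∈ F, ∑ J ∈ finsetChildren F I, q J ≤ ∑ J ∈ F, q J := by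
  classical
  rw [← Finset.sum_biUnion]
  · refine Finset.sum_le_sum_of_subset_of_nonneg ?_ fun _ _ _ => hq _
    intro J hJ
    obtain ⟨I, -, hJ⟩ := Finset.mem_biUnion.1 hJ
    exact (mem_finsetChildren.1 hJ).prop.1
  · intro I hI K hK hIK
    rw [Function.onFun, Finset.disjoint_left]
    intro J hJ hJ'
    rw [mem_finsetChildren] at hJ hJ'
    obtain ⟨x, hx⟩ := hne J hJ.prop.1
    rcases hnest I hI K hK with h | h | h
    · exact hJ.prop.2.not_subset (hJ'.le_of_ge ⟨hI, h.ssubset_of_ne hIK⟩ hJ.prop.2.subset)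
    · exact hJ'.prop.2.not_subset (hJ.le_of_ge ⟨hK, h.ssubset_of_ne hIK.symm⟩ hJ'.prop.2.subset)
    · exact Set.disjoint_left.1 h (hJ.prop.2.subset hx) (hJ'.prop.2.subset hx)

theorem setIntegral_eq_exceptionalPart_add_sum [MeasurableSpace X] {μ : Measure X}
    (hm : ∀ I ∈ F, MeasurableSet I)
    (hnest : ∀ I ∈ F, ∀ J ∈ F, I ⊆ J ∨ J ⊆ I ∨ Disjoint I J) {I : Set X}
    {g : X → ℝ} (hg : IntegrableOn g I μ) :
    ∫ x in I, g x ∂μ = ∫ x in exceptionalPart (F : Set (Set X)) I, g x ∂μ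
      + ∑ J ∈ finsetChildren F I, ∫ x in J, g x ∂μ := by
  have hch : ∀ J ∈ finsetChildren F I, J ∈ F ∧ J ⊂ I := fun J hJ => (mem_finsetChildren.1 hJ).prop
  have hsub : ⋃ J ∈ finsetChildren F I, J ⊆ I := Set.iUnion₂_subset fun J hJ => (hch J hJ).2.subset
  have hmU : MeasurableSet (⋃ J ∈ finsetChildren F I, J) :=
    Finset.measurableSet_biUnion _ fun J hJ => hm J (hch J hJ).1
  rw [exceptionalPart, sUnion_eq_biUnion_finsetChildren, ← integral_biUnion_finset (f := g)
    (finsetChildren F I) (fun J hJ => hm J (hch J hJ).1) ?_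
    (fun J hJ => hg.mono_set (hch J hJ).2.subset), ← setIntegral_union Set.disjoint_sdiff_left hmU
    (hg.mono_set Set.sdiff_subset) (hg.mono_set hsub), Set.sdiff_union_of_subset hsub]
  intro J hJ K hK hJK
  exact disjoint_of_maximal (hnest J (hch J hJ).1 K (hch K hK).1) (mem_finsetChildren.1 hJ)
    (mem_finsetChildren.1 hK) hJK

end Children

theorem MeasureTheory.MemLp.integrable_inner_of_two {X 𝕜 H : Type*} [MeasurableSpace X] [RCLike 𝕜]
    [NormedAddCommGroup H] [InnerProductSpace 𝕜 H] {μ : Measure X} {f g : X → H}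
    (hf : MemLp f 2 μ) (hg : MemLp g 2 μ) : Integrable (fun x => inner 𝕜 (f x) (g x)) μ :=
  (hf.norm.integrable_mul hg.norm).mono' (hf.1.inner hg.1)
    (Filter.Eventually.of_forall fun _ => norm_inner_le_norm _ _)

/-! ### The Doob-type inequality -/

/-- A Doob-type `L²` inequality: if, for members `J ⊆ I` of a finite nested family, the functions
`φ J` and `f` have the same pairing with `φ I` over `J`, then the functions `φ I` restricted to the
exceptional parts are controlled in `L²` by `f`. -/
theorem sum_setIntegral_exceptionalPart_norm_sq_le {X H : Type*} [MeasurableSpace X]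
    [NormedAddCommGroup H] [InnerProductSpace ℝ H] {μ : Measure X}
    {F : Finset (Set X)} (hm : ∀ I ∈ F, MeasurableSet I) (hne : ∀ I ∈ F, I.Nonempty)
    (hnest : ∀ I ∈ F, ∀ J ∈ F, I ⊆ J ∨ J ⊆ I ∨ Disjoint I J)
    {φ : Set X → X → H} (hφ : ∀ I ∈ F, MemLp (φ I) 2 (μ.restrict I))
    {f : X → H} (hf : MemLp f 2 μ)
    (horth : ∀ I ∈ F, ∀ J ∈ F, J ⊆ I →
      ∫ x in J, inner ℝ (φ J x) (φ I x) ∂μ = ∫ x in J, inner ℝ (f x) (φ I x) ∂μ) :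
    ∑ I ∈ F, ∫ x in exceptionalPart (F : Set (Set X)) I, ‖φ I x‖ ^ 2 ∂μ ≤ 4 * ∫ x, ‖f x‖ ^ 2 ∂μ := by
  set E : Set X → Set X := exceptionalPart (F : Set (Set X)) with hE
  set q : Set X → ℝ := fun J => ∫ x in J, ‖φ J x‖ ^ 2 ∂μ with hq
  have hEm : ∀ I ∈ F, MeasurableSet (E I) := fun I hI =>
    measurableSet_exceptionalPart F.countable_toSet hm (hm I hI)
  have hφ' : ∀ I ∈ F, ∀ s ⊆ I, MemLp (φ I) 2 (μ.restrict s) := fun I hI s hs =>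
    (hφ I hI).mono_measure (Measure.restrict_mono hs le_rfl)
  have hf' : ∀ s : Set X, MemLp f 2 (μ.restrict s) := fun s => hf.restrict s
  have sq_int : ∀ {s : Set X} {g : X → H}, MemLp g 2 (μ.restrict s) →
      IntegrableOn (fun x => ‖g x‖ ^ 2) s μ := fun h => (memLp_two_iff_integrable_sq_norm h.1).1 h
  have in_int : ∀ {s : Set X} {g h : X → H}, MemLp g 2 (μ.restrict s) →
      MemLp h 2 (μ.restrict s) → IntegrableOn (fun x => inner ℝ (g x) (h x)) s μ := fun hg hh => by
    exact hg.integrable_inner_of_two (𝕜 := ℝ) hh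
  -- Split `q I = ∫_I ⟨f, φ I⟩` over the exceptional part and the children. There use `‖f - φ I /
  -- 2‖² ≥ 0` and `‖φ J - φ I‖² ≥ 0` respectively, then subtract half of the same splitting of `∫_I
  -- ‖φ I‖²`.
  have key : ∀ I ∈ F, 1 / 2 * q I + 1 / 4 * ∫ x in E I, ‖φ I x‖ ^ 2 ∂μ
      ≤ ∫ x in E I, ‖f x‖ ^ 2 ∂μ + 1 / 2 * ∑ J ∈ finsetChildren F I, q J := by
    intro I hI
    have h1 : ∫ x in E I, inner ℝ (f x) (φ I x) ∂μ - 1 / 4 * ∫ x in E I, ‖φ I x‖ ^ 2 ∂μ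
        ≤ ∫ x in E I, ‖f x‖ ^ 2 ∂μ := by
      have a := hφ' I hI (E I) (exceptionalPart_subset _ _)
      rw [← integral_const_mul, ← integral_sub (in_int (hf' _) a) ((sq_int a).const_mul _)]
      refine integral_mono ((in_int (hf' _) a).sub ((sq_int a).const_mul _)) (sq_int (hf' _)) ?_
      intro x
      have := norm_sub_sq_real (f x) ((1 / 2 : ℝ) • φ I x)
      rw [inner_smul_right, norm_smul, Real.norm_of_nonneg (by norm_num)] at this
      simp only
      nlinarith [sq_nonneg ‖f x - (1 / 2 : ℝ) • φ I x‖]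
    have h2 : ∀ J ∈ finsetChildren F I, ∫ x in J, inner ℝ (f x) (φ I x) ∂μ
        - 1 / 2 * ∫ x in J, ‖φ I x‖ ^ 2 ∂μ ≤ 1 / 2 * q J := by
      intro J hJ
      have hJ' := (mem_finsetChildren.1 hJ).prop
      have a := hφ' I hI J hJ'.2.subset
      have b := hφ J hJ'.1
      rw [← horth I hI J hJ'.1 hJ'.2.subset, hq, ← integral_const_mul, ← integral_const_mul,
        ← integral_sub (in_int b a) ((sq_int a).const_mul _)]
      refine integral_mono ((in_int b a).sub ((sq_int a).const_mul _)) ((sq_int b).const_mul _) ?_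
      intro x
      have := norm_sub_sq_real (φ J x) (φ I x)
      simp only
      nlinarith [sq_nonneg ‖φ J x - φ I x‖]
    have h3 := Finset.sum_le_sum h2
    rw [Finset.sum_sub_distrib, ← Finset.mul_sum, ← Finset.mul_sum] at h3
    have h4 := setIntegral_eq_exceptionalPart_add_sum hm hnest
      (in_int (hf' I) (hφ I hI))
    have h5 := setIntegral_eq_exceptionalPart_add_sum hm hnest (sq_int (hφ I hI))
    have h6 : ∫ x in I, inner ℝ (f x) (φ I x) ∂μ = q I := by
      rw [← horth I hI I hI subset_rfl]
      simp only [real_inner_self_eq_norm_sq, hq]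
    rw [h6] at h4
    change q I = _ at h5
    rw [← hE] at h4 h5
    linarith
  have hsum := Finset.sum_le_sum key
  rw [Finset.sum_add_distrib, Finset.sum_add_distrib, ← Finset.mul_sum, ← Finset.mul_sum,
    ← Finset.mul_sum] at hsum
  -- Summing `key` over `F`, the children terms are absorbed by `∑ q I / 2` on the left; these are
  -- finite reals because `F` is finite.
  have hch := sum_sum_finsetChildren_le hne hnest (q := q) fun J => by positivity
  have hfE : ∑ I ∈ F, ∫ x in E I, ‖f x‖ ^ 2 ∂μ ≤ ∫ x, ‖f x‖ ^ 2 ∂μ := by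
    have hfi : Integrable (fun x => ‖f x‖ ^ 2) μ := (memLp_two_iff_integrable_sq_norm hf.1).1 hf
    rw [← integral_biUnion_finset F hEm ?_ fun I _ => hfi.integrableOn]
    · exact setIntegral_le_integral hfi (Filter.Eventually.of_forall fun x => by positivity)
    · exact fun I hI J hJ hIJ => disjoint_exceptionalPart hI hJ hIJ (hnest I hI J hJ)
  linarith

theorem sq_lintegral_mul_le {X : Type*} [MeasurableSpace X] {μ : Measure X} {f g : X → ℝ≥0∞}
    (hf : AEMeasurable f μ) (hg : AEMeasurable g μ) :
    (∫⁻ x, f x * g x ∂μ) ^ 2 ≤ (∫⁻ x, f x ^ 2 ∂μ) * ∫⁻ x, g x ^ 2 ∂μ := by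
  have h := ENNReal.lintegral_mul_le_Lp_mul_Lq μ Real.HolderConjugate.two_two hf hg
  simp only [Pi.mul_apply, ENNReal.rpow_two] at h
  calc (∫⁻ x, f x * g x ∂μ) ^ 2 ≤ _ := pow_le_pow_left' h 2
    _ = _ := by
      rw [mul_pow, ← ENNReal.rpow_two, ← ENNReal.rpow_two, ← ENNReal.rpow_mul, ← ENNReal.rpow_mul]
      norm_num

/-! ### Operator weights on a single set -/

section Weights

variable {X H : Type*} [MeasurableSpace X] [NormedAddCommGroup H] [InnerProductSpace ℂ H]
  [CompleteSpace H]

/-- Measurable self-adjoint operator-valued functions that are pointwise inverse to each other. -/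
structure IsInversePair (μ : Measure X) (U V : X → H →L[ℂ] H) : Prop where
  aesm_left : AEStronglyMeasurable U μ
  aesm_right : AEStronglyMeasurable V μ
  selfAdjoint_left : ∀ᵐ x ∂μ, IsSelfAdjoint (U x)
  selfAdjoint_right : ∀ᵐ x ∂μ, IsSelfAdjoint (V x)
  mul_left : ∀ᵐ x ∂μ, U x * V x = 1
  mul_right : ∀ᵐ x ∂μ, V x * U x = 1

/-- The double integral of `‖U x * V t‖ ^ 2` over `I × I`. -/
noncomputable def crossEnergy (μ : Measure X) (U V : X → H →L[ℂ] H) (I : Set X) : ℝ≥0∞ :=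
  ∫⁻ x in I, ∫⁻ t in I, ‖U x * V t‖ₑ ^ 2 ∂μ ∂μ

variable {μ : Measure X} {U V : X → H →L[ℂ] H}

namespace IsInversePair

theorem symm (h : IsInversePair μ U V) : IsInversePair μ V U :=
  ⟨h.aesm_right, h.aesm_left, h.selfAdjoint_right, h.selfAdjoint_left, h.mul_right, h.mul_left⟩

theorem aestronglyMeasurable_apply (h : IsInversePair μ U V) {f : X → H}
    (hf : AEStronglyMeasurable f μ) : AEStronglyMeasurable (fun x => U x (f x)) μ :=
  isBoundedBilinearMap_apply.continuous.comp_aestronglyMeasurable (h.aesm_left.prodMk hf)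

theorem aestronglyMeasurable_mul_right (h : IsInversePair μ U V) (x : X) :
    AEStronglyMeasurable (fun t => U x * V t) μ :=
  h.aesm_right.const_mul (U x)

theorem aemeasurable_enorm_mul_sq [SFinite μ] (h : IsInversePair μ U V) (I : Set X) :
    AEMeasurable (fun p : X × X => ‖U p.1 * V p.2‖ₑ ^ 2) ((μ.restrict I).prod (μ.restrict I)) :=
  ((h.aesm_left.restrict.comp_fst).mul (h.aesm_right.restrict.comp_snd)).enorm.pow_const 2

/-- Adjoints reverse the product and Tonelli swaps the variables, so every estimate for `U` also
holds for `V` with the same constant. -/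
theorem crossEnergy_comm [SFinite μ] (h : IsInversePair μ U V) (I : Set X) :
    crossEnergy μ V U I = crossEnergy μ U V I := by
  unfold crossEnergy
  rw [lintegral_lintegral_swap (h.symm.aemeasurable_enorm_mul_sq I)]
  have h1 := ae_restrict_of_ae (s := I) h.selfAdjoint_left
  have h2 := ae_restrict_of_ae (s := I) h.selfAdjoint_right
  refine lintegral_congr_ae (h1.mono fun t ht => lintegral_congr_ae (h2.mono fun x hx => ?_))
  simp only
  congr 1
  rw [← ofReal_norm, ← ofReal_norm, ← norm_star (U t * V x), star_mul, ht.star_eq, hx.star_eq]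

variable (h : IsInversePair μ U V)
include h

theorem enorm_apply_le_left (v : H) (x : X) :
    ∀ᵐ t ∂μ, ‖U x v‖ₑ ≤ ‖U x * V t‖ₑ * ‖U t v‖ₑ := by
  filter_upwards [h.mul_right] with t ht
  calc ‖U x v‖ₑ = ‖(U x * V t) (U t v)‖ₑ := by
        have : (V t * U t) v = v := by rw [ht]; rfl
        change _ = ‖U x ((V t * U t) v)‖ₑ
        rw [this]
    _ ≤ _ := ContinuousLinearMap.le_opENorm _ _

/-- Average `|U x v| ≤ ‖U x V t‖ |U t v|` over `t ∈ E`, apply Cauchy-Schwarz, and integrate over `x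
∈ I`. The 4 is the square of the ratio bound `μ I ≤ 2 μ E`. -/
theorem lintegral_enorm_apply_sq_le [SFinite μ] {A : ℝ≥0∞} {I E : Set X} (hI : μ I ≠ ∞) (hI0 : μ I ≠ 0)
    (hEI : E ⊆ I) (hE : μ I ≤ 2 * μ E) (hA : crossEnergy μ U V I ≤ A * μ I ^ 2) (v : H) :
    ∫⁻ x in I, ‖U x v‖ₑ ^ 2 ∂μ ≤ 4 * A * ∫⁻ x in E, ‖U x v‖ₑ ^ 2 ∂μ := by
  have hEt : μ E ≠ ∞ := ((measure_mono hEI).trans_lt hI.lt_top).ne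
  have hE0 : μ E ≠ 0 := by rintro h0; simp [h0] at hE; exact hI0 hE
  have hv : AEStronglyMeasurable (fun x => U x v) μ :=
    h.aestronglyMeasurable_apply aestronglyMeasurable_const
  have key : ∀ x, μ E ^ 2 * ‖U x v‖ₑ ^ 2
      ≤ (∫⁻ t in I, ‖U x * V t‖ₑ ^ 2 ∂μ) * ∫⁻ t in E, ‖U t v‖ₑ ^ 2 ∂μ := by
    intro x
    calc μ E ^ 2 * ‖U x v‖ₑ ^ 2 = (∫⁻ _ in E, ‖U x v‖ₑ ∂μ) ^ 2 := by
          rw [setLIntegral_const]; ring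
      _ ≤ (∫⁻ t in E, ‖U x * V t‖ₑ * ‖U t v‖ₑ ∂μ) ^ 2 :=
          pow_le_pow_left' (lintegral_mono_ae (ae_restrict_of_ae (h.enorm_apply_le_left v x))) 2
      _ ≤ _ := sq_lintegral_mul_le (h.aestronglyMeasurable_mul_right x).restrict.enorm
          hv.restrict.enorm
      _ ≤ _ := by gcongr
  have h2 : μ E ^ 2 * ∫⁻ x in I, ‖U x v‖ₑ ^ 2 ∂μ
      ≤ μ E ^ 2 * (4 * A * ∫⁻ x in E, ‖U x v‖ₑ ^ 2 ∂μ) := by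
    calc _ = ∫⁻ x in I, μ E ^ 2 * ‖U x v‖ₑ ^ 2 ∂μ :=
          (lintegral_const_mul' _ _ (ENNReal.pow_ne_top hEt)).symm
      _ ≤ ∫⁻ x in I, (∫⁻ t in I, ‖U x * V t‖ₑ ^ 2 ∂μ) * ∫⁻ t in E, ‖U t v‖ₑ ^ 2 ∂μ ∂μ :=
          lintegral_mono key
      _ = crossEnergy μ U V I * ∫⁻ t in E, ‖U t v‖ₑ ^ 2 ∂μ :=
          lintegral_mul_const'' _ (h.aemeasurable_enorm_mul_sq I).lintegral_prod_right'
      _ ≤ (A * (2 * μ E) ^ 2) * ∫⁻ t in E, ‖U t v‖ₑ ^ 2 ∂μ := by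
          gcongr
          exact hA.trans (by gcongr)
      _ = _ := by ring
  exact (ENNReal.mul_le_mul_iff_right (pow_ne_zero 2 hE0) (ENNReal.pow_ne_top hEt)).1 h2

/-- By Fubini some fixed `x` with `U x` invertible has `∫_I ‖V x * U t‖² dt` finite; then `U t = U x
* (V x * U t)`. -/
theorem memLp_restrict [SFinite μ] {I : Set X} (hI0 : μ I ≠ 0) (hA : crossEnergy μ U V I ≠ ∞) :
    MemLp U 2 (μ.restrict I) := by
  rw [← h.crossEnergy_comm] at hA
  have hne : (ae (μ.restrict I)).NeBot := ae_neBot.2 (by simpa using hI0)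
  obtain ⟨x, hx, hxm⟩ := ((ae_lt_top' (h.symm.aemeasurable_enorm_mul_sq I).lintegral_prod_right'
    hA).and (ae_restrict_of_ae h.mul_left)).exists
  refine ⟨h.aesm_left.restrict, ?_⟩
  rw [eLpNorm_lt_top_iff_lintegral_rpow_enorm_lt_top (by norm_num) (by norm_num)]
  simp only [ENNReal.toReal_ofNat, ENNReal.rpow_ofNat]
  calc ∫⁻ t in I, ‖U t‖ₑ ^ 2 ∂μ ≤ ∫⁻ t in I, ‖U x‖ₑ ^ 2 * ‖V x * U t‖ₑ ^ 2 ∂μ := by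
        refine lintegral_mono fun t => ?_
        have : U t = U x * (V x * U t) := by rw [← mul_assoc, hxm, one_mul]
        rw [← mul_pow]
        gcongr
        conv_lhs => rw [this]
        simp only [← ofReal_norm]
        rw [← ENNReal.ofReal_mul (norm_nonneg _)]
        exact ENNReal.ofReal_le_ofReal (norm_mul_le _ _)
    _ = ‖U x‖ₑ ^ 2 * ∫⁻ t in I, ‖V x * U t‖ₑ ^ 2 ∂μ :=
        lintegral_const_mul' _ _ (ENNReal.pow_ne_top enorm_ne_top)
    _ < ∞ := ENNReal.mul_lt_top (ENNReal.pow_lt_top enorm_lt_top) hx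

omit h [CompleteSpace H] in
theorem memLp_apply_const (hU : MemLp U 2 μ) (v : H) : MemLp (fun x => U x v) 2 μ :=
  ContinuousLinearMap.comp_memLp' (ContinuousLinearMap.apply ℂ H v) hU

omit h [CompleteSpace H] in
theorem integrable_apply (hU : MemLp U 2 μ) {f : X → H} (hf : MemLp f 2 μ) :
    Integrable (fun x => U x (f x)) μ :=
  (hU.norm.integrable_mul hf.norm).mono'
    (isBoundedBilinearMap_apply.continuous.comp_aestronglyMeasurable (hU.1.prodMk hf.1))
    (Filter.Eventually.of_forall fun _ => ContinuousLinearMap.le_opNorm _ _)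

theorem inner_integral_apply (hU : MemLp U 2 μ) {f : X → H} (hf : MemLp f 2 μ) (v : H) :
    inner ℂ (∫ x, U x (f x) ∂μ) v = ∫ x, inner ℂ (f x) (U x v) ∂μ := by
  rw [← inner_conj_symm, ← integral_inner (integrable_apply hU hf), ← integral_conj]
  refine integral_congr_ae (h.selfAdjoint_left.mono fun x hx => ?_)
  simp only
  rw [inner_conj_symm]
  exact (ContinuousLinearMap.isSelfAdjoint_iff_isSymmetric.1 hx) (f x) v

theorem restrict (I : Set X) : IsInversePair (μ.restrict I) U V :=
  ⟨h.aesm_left.restrict, h.aesm_right.restrict, ae_restrict_of_ae h.selfAdjoint_left,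
    ae_restrict_of_ae h.selfAdjoint_right, ae_restrict_of_ae h.mul_left,
    ae_restrict_of_ae h.mul_right⟩

/-- The operator `∫ U²` is injective, since its quadratic form at `w` is `∫ |U w|²`, and so
surjective in finite dimension. This supplies the projections. -/
theorem exists_integral_apply_apply_eq [FiniteDimensional ℂ H] (hμ : μ ≠ 0) (hU : MemLp U 2 μ)
    (b : H) : ∃ w, ∫ x, U x (U x w) ∂μ = b := by
  let T : H →ₗ[ℂ] H :=
    { toFun := fun w => ∫ x, U x (U x w) ∂μ
      map_add' := fun v w => by
        simp only [map_add]
        exact integral_add (integrable_apply hU (memLp_apply_const hU v))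
          (integrable_apply hU (memLp_apply_const hU w))
      map_smul' := fun c w => by
        simp only [map_smul, RingHom.id_apply]
        exact integral_smul _ _ }
  have hT : Function.Injective T := by
    rw [injective_iff_map_eq_zero]
    intro w hw
    have hi : inner ℂ (T w) w = ∫ x, inner ℂ (U x w) (U x w) ∂μ :=
      h.inner_integral_apply hU (memLp_apply_const hU w) w
    rw [hw, inner_zero_left] at hi
    have hsq : ∫ x, ‖U x w‖ ^ 2 ∂μ = 0 := by
      have : ((∫ x, ‖U x w‖ ^ 2 ∂μ : ℝ) : ℂ) = 0 := by
        rw [hi, ← integral_complex_ofReal]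
        refine integral_congr_ae (Filter.Eventually.of_forall fun x => ?_)
        simp only
        rw [inner_self_eq_norm_sq_to_K]
        push_cast
        rfl
      exact_mod_cast this
    have hint := (memLp_two_iff_integrable_sq_norm (memLp_apply_const hU w).1).1
      (memLp_apply_const hU w)
    rw [integral_eq_zero_iff_of_nonneg (fun x => by positivity) hint] at hsq
    have hne : (ae μ).NeBot := ae_neBot.2 hμ
    obtain ⟨x, hx, hxm⟩ := (hsq.and h.mul_right).exists
    have hx' : U x w = 0 := by simpa using hx
    calc w = (V x * U x) w := by rw [hxm]; rfl
      _ = V x (U x w) := rfl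
      _ = 0 := by rw [hx', map_zero]
  exact (LinearMap.injective_iff_surjective.1 hT) b

/-- With `a = ∫ V² w`, the pairing is `∫ ⟨U a, U u⟩`. Bringing `U x` inside the integral defining
`a` produces `U x * V t`, so the cross energy enters only once. -/
theorem enorm_inner_integral_sq_le [SFinite μ] (hU : MemLp U 2 μ) (hV : MemLp V 2 μ) (w u : H) :
    ‖inner ℂ (∫ x, V x (V x w) ∂μ) (∫ x, U x (U x u) ∂μ)‖ₑ ^ 2
      ≤ crossEnergy μ U V Set.univ * (∫⁻ x, ‖V x w‖ₑ ^ 2 ∂μ) * ∫⁻ x, ‖U x u‖ₑ ^ 2 ∂μ := by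
  set a := ∫ x, V x (V x w) ∂μ with ha
  have hUa : ∀ x, ‖U x a‖ₑ ^ 2 ≤ (∫⁻ t, ‖U x * V t‖ₑ ^ 2 ∂μ) * ∫⁻ t, ‖V t w‖ₑ ^ 2 ∂μ := by
    intro x
    calc ‖U x a‖ₑ ^ 2 = ‖∫ t, U x (V t (V t w)) ∂μ‖ₑ ^ 2 := by
          rw [ha, ContinuousLinearMap.integral_comp_comm _
            (integrable_apply hV (memLp_apply_const hV w))]
      _ ≤ (∫⁻ t, ‖U x * V t‖ₑ * ‖V t w‖ₑ ∂μ) ^ 2 := by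
          gcongr
          refine (enorm_integral_le_lintegral_enorm _).trans (lintegral_mono fun t => ?_)
          exact (U x * V t).le_opENorm (V t w)
      _ ≤ _ := sq_lintegral_mul_le (h.aestronglyMeasurable_mul_right x).enorm
          (memLp_apply_const hV w).1.enorm
  have hin : ‖inner ℂ a (∫ x, U x (U x u) ∂μ)‖ₑ ≤ ∫⁻ x, ‖U x a‖ₑ * ‖U x u‖ₑ ∂μ := by
    rw [← ofReal_norm, norm_inner_symm, h.inner_integral_apply hU (memLp_apply_const hU u), ofReal_norm]
    refine (enorm_integral_le_lintegral_enorm _).trans (lintegral_mono fun x => ?_)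
    simp only [← ofReal_norm]
    rw [← ENNReal.ofReal_mul (norm_nonneg _), mul_comm]
    exact ENNReal.ofReal_le_ofReal (norm_inner_le_norm _ _)
  calc _ ≤ (∫⁻ x, ‖U x a‖ₑ * ‖U x u‖ₑ ∂μ) ^ 2 := pow_le_pow_left' hin 2
    _ ≤ (∫⁻ x, ‖U x a‖ₑ ^ 2 ∂μ) * ∫⁻ x, ‖U x u‖ₑ ^ 2 ∂μ :=
        sq_lintegral_mul_le (memLp_apply_const hU a).1.enorm (memLp_apply_const hU u).1.enorm
    _ ≤ _ := by
        gcongr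
        refine (lintegral_mono hUa).trans_eq ?_
        have := (h.restrict Set.univ).aemeasurable_enorm_mul_sq Set.univ
        simp only [Measure.restrict_univ] at this
        rw [lintegral_mul_const'' _ this.lintegral_prod_right', crossEnergy]
        simp only [Measure.restrict_univ]

end IsInversePair
end Weights

theorem ENNReal.sq_sum_le_sum_mul_sum_of_sq_le_mul {ι : Type*} (s : Finset ι) {r a b : ι → ℝ≥0∞}
    (h : ∀ i ∈ s, r i ^ 2 ≤ a i * b i) : (∑ i ∈ s, r i) ^ 2 ≤ (∑ i ∈ s, a i) * ∑ i ∈ s, b i := by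
  have hr : ∀ i ∈ s, r i ≤ a i ^ (1 / 2 : ℝ) * b i ^ (1 / 2 : ℝ) := fun i hi => by
    rw [← ENNReal.mul_rpow_of_nonneg _ _ (by norm_num : (0 : ℝ) ≤ 1 / 2),
      one_div, ENNReal.le_rpow_inv_iff (by norm_num), ENNReal.rpow_two]
    exact h i hi
  calc (∑ i ∈ s, r i) ^ 2 ≤ (∑ i ∈ s, a i ^ (1 / 2 : ℝ) * b i ^ (1 / 2 : ℝ)) ^ 2 :=
        pow_le_pow_left' (Finset.sum_le_sum hr) 2
    _ ≤ _ := pow_le_pow_left' (ENNReal.inner_le_Lp_mul_Lq s _ _ Real.HolderConjugate.two_two) 2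
    _ = _ := by
      rw [mul_pow, ← ENNReal.rpow_two, ← ENNReal.rpow_two]
      simp only [← ENNReal.rpow_mul]
      norm_num

theorem MeasureTheory.MemLp.lintegral_enorm_sq_eq {X H : Type*} [MeasurableSpace X]
    [NormedAddCommGroup H] {μ : Measure X} {f : X → H} (hf : MemLp f 2 μ) :
    ∫⁻ x, ‖f x‖ₑ ^ 2 ∂μ = ENNReal.ofReal (∫ x, ‖f x‖ ^ 2 ∂μ) := by
  rw [ofReal_integral_eq_lintegral_ofReal ((memLp_two_iff_integrable_sq_norm hf.1).1 hf)
    (Filter.Eventually.of_forall fun x => by positivity)]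
  simp only [← ofReal_norm, ENNReal.ofReal_pow (norm_nonneg _)]

theorem MeasureTheory.MemLp.lintegral_enorm_sq_lt_top {X H : Type*} [MeasurableSpace X]
    [NormedAddCommGroup H] {μ : Measure X} {f : X → H} (hf : MemLp f 2 μ) :
    ∫⁻ x, ‖f x‖ₑ ^ 2 ∂μ < ∞ :=
  hf.lintegral_enorm_sq_eq ▸ ENNReal.ofReal_lt_top

theorem MeasureTheory.ofReal_measureReal_inv {X : Type*} [MeasurableSpace X] {μ : Measure X}
    {s : Set X} (h0 : μ s ≠ 0) (ht : μ s ≠ ∞) : ENNReal.ofReal (μ.real s)⁻¹ = (μ s)⁻¹ := by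
  rw [measureReal_def, ENNReal.ofReal_inv_of_pos (ENNReal.toReal_pos h0 ht), ENNReal.ofReal_toReal ht]

/-! ### Nested sparse families and finite sparse sums -/

/-- A countable nested family of sets of positive finite measure, each of which is covered by its
strictly smaller members up to at least half of its measure. -/
structure IsNestedSparse {X : Type*} [MeasurableSpace X] (μ : Measure X) (G : Set (Set X)) :
    Prop where
  countable : G.Countable
  measurableSet : ∀ I ∈ G, MeasurableSet I
  nested : ∀ I ∈ G, ∀ J ∈ G, I ⊆ J ∨ J ⊆ I ∨ Disjoint I J
  measure_ne_zero : ∀ I ∈ G, μ I ≠ 0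
  measure_ne_top : ∀ I ∈ G, μ I ≠ ∞
  le_two_mul : ∀ I ∈ G, μ I ≤ 2 * μ (exceptionalPart G I)

theorem IsNestedSparse.mono {X : Type*} [MeasurableSpace X] {μ : Measure X} {G G' : Set (Set X)}
    (hG : IsNestedSparse μ G) (h : G' ⊆ G) : IsNestedSparse μ G' where
  countable := hG.countable.mono h
  measurableSet I hI := hG.measurableSet I (h hI)
  nested I hI J hJ := hG.nested I (h hI) J (h hJ)
  measure_ne_zero I hI := hG.measure_ne_zero I (h hI)
  measure_ne_top I hI := hG.measure_ne_top I (h hI)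
  le_two_mul I hI := (hG.le_two_mul I (h hI)).trans (by gcongr; exact exceptionalPart_anti h I)

namespace IsInversePair

variable {X H : Type*} [MeasurableSpace X] [NormedAddCommGroup H] [InnerProductSpace ℂ H]
  [CompleteSpace H] {μ : Measure X} {U V : X → H →L[ℂ] H}

omit [CompleteSpace H] in
theorem crossEnergy_restrict_univ (I : Set X) :
    crossEnergy (μ.restrict I) U V Set.univ = crossEnergy μ U V I := by
  simp only [crossEnergy, Measure.restrict_univ]

theorem memLp_of_crossEnergy_le [SFinite μ] (h : IsInversePair μ U V) {G : Set (Set X)}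
    (hG : IsNestedSparse μ G) {A : ℝ≥0} (hA : ∀ I ∈ G, crossEnergy μ U V I ≤ A * μ I ^ 2)
    {I : Set X} (hI : I ∈ G) : MemLp U 2 (μ.restrict I) :=
  h.memLp_restrict (hG.measure_ne_zero I hI) ((hA I hI).trans_lt (ENNReal.mul_lt_top
    ENNReal.coe_lt_top (ENNReal.pow_lt_top (hG.measure_ne_top I hI).lt_top))).ne

variable [SFinite μ] [FiniteDimensional ℂ H]

/-- A matrix-weighted Carleson embedding for nested sparse families. -/
theorem exists_sum_lintegral_le (h : IsInversePair μ U V) {F : Finset (Set X)}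
    (hF : IsNestedSparse μ (F : Set (Set X))) {A : ℝ≥0}
    (hA : ∀ I ∈ F, crossEnergy μ U V I ≤ A * μ I ^ 2) {f : X → H} (hf : MemLp f 2 μ) :
    ∃ w : Set X → H, (∀ I ∈ F, ∫ x in I, U x (U x (w I)) ∂μ = ∫ x in I, U x (f x) ∂μ) ∧
      ∑ I ∈ F, ∫⁻ x in I, ‖U x (w I)‖ₑ ^ 2 ∂μ ≤ 16 * A * ∫⁻ x, ‖f x‖ₑ ^ 2 ∂μ := by
  have hU : ∀ I ∈ F, MemLp U 2 (μ.restrict I) := fun I hI => h.memLp_of_crossEnergy_le hF hA hI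
  have hw : ∀ I, ∃ w, I ∈ F → ∫ x in I, U x (U x w) ∂μ = ∫ x in I, U x (f x) ∂μ := fun I => by
    by_cases hI : I ∈ F
    · obtain ⟨w, hw⟩ := (h.restrict I).exists_integral_apply_apply_eq
        (by simpa using hF.measure_ne_zero I hI) (hU I hI) (∫ x in I, U x (f x) ∂μ)
      exact ⟨w, fun _ => hw⟩
    · exact ⟨0, fun hI' => absurd hI' hI⟩
  choose w hw using hw
  refine ⟨w, hw, ?_⟩
  -- The Doob inequality is stated for real inner products; the real structure is given by real
  -- parts.
  let _ : InnerProductSpace ℝ H := InnerProductSpace.rclikeToReal ℂ H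
  have hre : ∀ {J : Set X} {g₁ g₂ : X → H}, MemLp g₁ 2 (μ.restrict J) →
      MemLp g₂ 2 (μ.restrict J) →
      ∫ x in J, inner ℝ (g₁ x) (g₂ x) ∂μ = (∫ x in J, inner ℂ (g₁ x) (g₂ x) ∂μ).re :=
    fun h₁ h₂ => integral_re (h₁.integrable_inner_of_two (𝕜 := ℂ) h₂)
  have hD := sum_setIntegral_exceptionalPart_norm_sq_le (φ := fun I x => U x (w I))
    hF.measurableSet (fun I hI => nonempty_of_measure_ne_zero (hF.measure_ne_zero I hI)) hF.nested
    -- Moving `U` across the pairing, both sides become the real part of `⟨∫_J U (·), w I⟩`, and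
    -- these agree by the choice of `w J`.
    (fun I hI => memLp_apply_const (hU I hI) (w I)) hf fun I hI J hJ hJI => by
      have hJw := memLp_apply_const (hU J hJ) (w I)
      rw [hre (memLp_apply_const (hU J hJ) (w J)) hJw, hre (hf.restrict J) hJw,
        ← (h.restrict J).inner_integral_apply (hU J hJ) (memLp_apply_const (hU J hJ) (w J)),
        ← (h.restrict J).inner_integral_apply (hU J hJ) (hf.restrict J), hw J hJ]
  calc ∑ I ∈ F, ∫⁻ x in I, ‖U x (w I)‖ₑ ^ 2 ∂μ
      ≤ ∑ I ∈ F, 4 * A * ∫⁻ x in exceptionalPart (F : Set (Set X)) I, ‖U x (w I)‖ₑ ^ 2 ∂μ :=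
        Finset.sum_le_sum fun I hI => h.lintegral_enorm_apply_sq_le (hF.measure_ne_top I hI)
          (hF.measure_ne_zero I hI) (exceptionalPart_subset _ _) (hF.le_two_mul I hI) (hA I hI) _
    _ = 4 * A * ENNReal.ofReal (∑ I ∈ F,
          ∫ x in exceptionalPart (F : Set (Set X)) I, ‖U x (w I)‖ ^ 2 ∂μ) := by
        rw [← Finset.mul_sum, ENNReal.ofReal_sum_of_nonneg fun I _ => by positivity]
        congr 1
        refine Finset.sum_congr rfl fun I hI => MemLp.lintegral_enorm_sq_eq ?_
        exact (memLp_apply_const (hU I hI) (w I)).mono_measure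
          (Measure.restrict_mono (exceptionalPart_subset _ _) le_rfl)
    _ ≤ 4 * A * ENNReal.ofReal (4 * ∫ x, ‖f x‖ ^ 2 ∂μ) := by gcongr
    _ = _ := by
        rw [ENNReal.ofReal_mul (by norm_num), ← hf.lintegral_enorm_sq_eq]
        norm_num
        ring

/-- One factor `A` comes from the pairing on each `I`, and `16 A` from each of the two embeddings,
for `V` with `f` and for `U` with `g`. -/
theorem sq_sum_enorm_inner_le (h : IsInversePair μ U V) {F : Finset (Set X)}
    (hF : IsNestedSparse μ (F : Set (Set X))) {A : ℝ≥0}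
    (hA : ∀ I ∈ F, crossEnergy μ U V I ≤ A * μ I ^ 2) {f g : X → H} (hf : MemLp f 2 μ)
    (hg : MemLp g 2 μ) :
    (∑ I ∈ F, (μ I)⁻¹ * ‖inner ℂ (∫ x in I, V x (f x) ∂μ) (∫ x in I, U x (g x) ∂μ)‖ₑ) ^ 2
      ≤ 256 * A ^ 3 * (∫⁻ x, ‖f x‖ₑ ^ 2 ∂μ) * ∫⁻ x, ‖g x‖ₑ ^ 2 ∂μ := by
  have hA' : ∀ I ∈ F, crossEnergy μ V U I ≤ A * μ I ^ 2 := fun I hI =>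
    (h.crossEnergy_comm I).trans_le (hA I hI)
  obtain ⟨w, hw, hws⟩ := h.symm.exists_sum_lintegral_le hF hA' hf
  obtain ⟨u, hu, hus⟩ := h.exists_sum_lintegral_le hF hA hg
  calc _ ≤ (∑ I ∈ F, A * ∫⁻ x in I, ‖V x (w I)‖ₑ ^ 2 ∂μ) *
        ∑ I ∈ F, ∫⁻ x in I, ‖U x (u I)‖ₑ ^ 2 ∂μ := by
        refine ENNReal.sq_sum_le_sum_mul_sum_of_sq_le_mul F fun I hI => ?_
        rw [← hw I hI, ← hu I hI, mul_pow]
        have := (h.restrict I).enorm_inner_integral_sq_le (h.memLp_of_crossEnergy_le hF hA hI)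
          (h.symm.memLp_of_crossEnergy_le hF hA' hI) (w I) (u I)
        rw [crossEnergy_restrict_univ] at this
        have hI0 := hF.measure_ne_zero I hI
        have hIt := hF.measure_ne_top I hI
        calc _ ≤ (μ I)⁻¹ ^ 2 * (A * μ I ^ 2 * (∫⁻ x in I, ‖V x (w I)‖ₑ ^ 2 ∂μ) *
              ∫⁻ x in I, ‖U x (u I)‖ₑ ^ 2 ∂μ) := by
              gcongr
              exact this.trans (by gcongr; exact hA I hI)
          _ = ((μ I)⁻¹ * μ I) ^ 2 * (A * (∫⁻ x in I, ‖V x (w I)‖ₑ ^ 2 ∂μ) *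
              ∫⁻ x in I, ‖U x (u I)‖ₑ ^ 2 ∂μ) := by ring
          _ = _ := by rw [ENNReal.inv_mul_cancel hI0 hIt, one_pow, one_mul]
    _ ≤ (A * (16 * A * ∫⁻ x, ‖f x‖ₑ ^ 2 ∂μ)) * (16 * A * ∫⁻ x, ‖g x‖ₑ ^ 2 ∂μ) := by
        rw [← Finset.mul_sum]
        gcongr
    _ = _ := by ring

/-- `L²` bound for finite sparse sums. -/
theorem lintegral_enorm_sum_indicator_sq_le (h : IsInversePair μ U V) {F : Finset (Set X)}
    (hF : IsNestedSparse μ (F : Set (Set X))) {A : ℝ≥0}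
    (hA : ∀ I ∈ F, crossEnergy μ U V I ≤ A * μ I ^ 2) {f : X → H} (hf : MemLp f 2 μ) :
    ∫⁻ x, ‖U x (∑ I ∈ F, I.indicator (fun _ => ⨍ y in I, V y (f y) ∂μ) x)‖ₑ ^ 2 ∂μ
      ≤ 256 * A ^ 3 * ∫⁻ x, ‖f x‖ₑ ^ 2 ∂μ := by
  set a : Set X → H := fun I => ⨍ y in I, V y (f y) ∂μ with ha
  have hU : ∀ I ∈ F, MemLp U 2 (μ.restrict I) := fun I hI => h.memLp_of_crossEnergy_le hF hA hI
  set Φ : X → H := fun x => U x (∑ I ∈ F, I.indicator (fun _ => a I) x) with hΦ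
  have hΦs : Φ = fun x => ∑ I ∈ F, I.indicator (fun x => U x (a I)) x := by
    funext x
    simp only [hΦ, map_sum]
    refine Finset.sum_congr rfl fun I _ => ?_
    by_cases hx : x ∈ I <;> simp [hx]
  have hΦ2 : MemLp Φ 2 μ := by
    rw [hΦs]
    refine memLp_finsetSum F fun I hI => ?_
    rw [memLp_indicator_iff_restrict (hF.measurableSet I hI)]
    exact memLp_apply_const (hU I hI) _
  have hself : ∫⁻ x, ‖Φ x‖ₑ ^ 2 ∂μ
      ≤ ∑ I ∈ F, (μ I)⁻¹ * ‖inner ℂ (∫ x in I, V x (f x) ∂μ) (∫ x in I, U x (Φ x) ∂μ)‖ₑ := by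
    have h1 : (∫ x, inner ℂ (Φ x) (Φ x) ∂μ) = ∑ I ∈ F, inner ℂ (∫ x in I, U x (Φ x) ∂μ) (a I) := by
      calc (∫ x, inner ℂ (Φ x) (Φ x) ∂μ)
          = ∫ x, ∑ I ∈ F, I.indicator (fun x => inner ℂ (Φ x) (U x (a I))) x ∂μ := by
            refine integral_congr_ae (Filter.Eventually.of_forall fun x => ?_)
            simp only
            conv_lhs => arg 3; rw [hΦs]
            rw [inner_sum]
            refine Finset.sum_congr rfl fun I _ => ?_
            by_cases hx : x ∈ I <;> simp [hx]
        _ = ∑ I ∈ F, ∫ x in I, inner ℂ (Φ x) (U x (a I)) ∂μ := by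
            rw [integral_finsetSum]
            · exact Finset.sum_congr rfl fun I hI => integral_indicator (hF.measurableSet I hI)
            · intro I hI
              rw [integrable_indicator_iff (hF.measurableSet I hI)]
              exact (hΦ2.restrict I).integrable_inner_of_two (memLp_apply_const (hU I hI) _)
        _ = _ := Finset.sum_congr rfl fun I hI =>
            ((h.restrict I).inner_integral_apply (hU I hI) (hΦ2.restrict I) _).symm
    have h2 : ∫⁻ x, ‖Φ x‖ₑ ^ 2 ∂μ = ‖∫ x, inner ℂ (Φ x) (Φ x) ∂μ‖ₑ := by
      have : (∫ x, inner ℂ (Φ x) (Φ x) ∂μ) = ((∫ x, ‖Φ x‖ ^ 2 ∂μ : ℝ) : ℂ) := by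
        rw [← integral_complex_ofReal]
        refine integral_congr_ae (Filter.Eventually.of_forall fun x => ?_)
        simp only
        rw [inner_self_eq_norm_sq_to_K]
        push_cast
        rfl
      rw [this, hΦ2.lintegral_enorm_sq_eq, ← ofReal_norm, Complex.norm_real,
        Real.norm_of_nonneg (by positivity)]
    rw [h2, h1]
    refine (enorm_sum_le _ _).trans (Finset.sum_le_sum fun I hI => ?_)
    rw [← ofReal_norm, ← ofReal_norm, norm_inner_symm, ha]
    simp only
    rw [setAverage_eq, ← Complex.coe_smul, inner_smul_left, norm_mul, ENNReal.ofReal_mul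
      (norm_nonneg _), RCLike.norm_conj, Complex.norm_real, Real.norm_of_nonneg (by positivity),
      ofReal_measureReal_inv (hF.measure_ne_zero I hI) (hF.measure_ne_top I hI)]
  -- Duality with `Φ` as its own test function: `‖Φ‖⁴ ≤ 256 A³ ‖f‖² ‖Φ‖²`. Cancelling needs `‖Φ‖`
  -- finite, which holds for a finite family.
  have hmain := (pow_le_pow_left' hself 2).trans (h.sq_sum_enorm_inner_le hF hA hf hΦ2)
  by_cases h0 : ∫⁻ x, ‖Φ x‖ₑ ^ 2 ∂μ = 0
  · rw [h0]; exact zero_le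
  · rw [sq] at hmain
    exact (ENNReal.mul_le_mul_iff_left h0 hΦ2.lintegral_enorm_sq_lt_top.ne).1 hmain

/-- Absolute convergence of the averages over the members of the family containing a fixed set. -/
theorem summable_average_of_subset (h : IsInversePair μ U V) {G : Set (Set X)}
    (hG : IsNestedSparse μ G) {A : ℝ≥0}
    (hA : ∀ I ∈ G, crossEnergy μ U V I ≤ A * μ I ^ 2) {f : X → H} (hf : MemLp f 2 μ)
    {Q : Set X} (hQ : MeasurableSet Q) (hQ0 : μ Q ≠ 0) (hQt : μ Q ≠ ∞)
    (hV : MemLp V 2 (μ.restrict Q)) (hQG : ∀ I ∈ G, Q ⊆ I) :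
    Summable fun I : G => ⨍ y in (I : Set X), V y (f y) ∂μ := by
  set a : Set X → H := fun I => ⨍ y in I, V y (f y) ∂μ with ha
  have hcoord : ∀ e : H, Summable fun I : G => ‖inner ℂ e (a I)‖ := by
    intro e
    -- With this test function `∫_I U g = μ(Q) e` for every `I ⊇ Q`, so the bilinear bound controls
    -- `∑ |⟨e, a I⟩|`.
    set g : X → H := Q.indicator fun x => V x e with hg
    have hg2 : MemLp g 2 μ := by
      rw [hg, memLp_indicator_iff_restrict hQ]
      exact memLp_apply_const hV e
    set M := 256 * A ^ 3 * (∫⁻ x, ‖f x‖ₑ ^ 2 ∂μ) * ∫⁻ x, ‖g x‖ₑ ^ 2 ∂μ with hM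
    have hMt : M < ∞ := ENNReal.mul_lt_top (ENNReal.mul_lt_top (ENNReal.mul_lt_top
      (by norm_num) (ENNReal.pow_lt_top ENNReal.coe_lt_top)) hf.lintegral_enorm_sq_lt_top)
      hg2.lintegral_enorm_sq_lt_top
    have hgI : ∀ I ∈ G, ∫ x in I, U x (g x) ∂μ = (μ.real Q : ℂ) • e := by
      intro I hI
      have : ∀ᵐ x ∂μ, U x (g x) = Q.indicator (fun _ => e) x := by
        filter_upwards [h.mul_left] with x hx
        by_cases hxQ : x ∈ Q
        · simp only [hg, hxQ, Set.indicator_of_mem]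
          change (U x * V x) e = e
          rw [hx]; rfl
        · simp [hg, hxQ]
      rw [integral_congr_ae (ae_restrict_of_ae this), integral_indicator hQ,
        Measure.restrict_restrict hQ, Set.inter_eq_left.2 (hQG I hI), setIntegral_const,
        Complex.coe_smul]
    have hbd : ∀ F : Finset G, ∑ I ∈ F, ‖inner ℂ e (a I)‖ ≤ ((μ Q)⁻¹ * (M + 1)).toReal := by
      intro F
      have hFG : ((F.map (Function.Embedding.subtype _) : Finset (Set X)) : Set (Set X)) ⊆ G := by
        intro I hI
        obtain ⟨J, -, rfl⟩ := Finset.mem_map.1 (Finset.mem_coe.1 hI)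
        exact J.2
      have h1 := h.sq_sum_enorm_inner_le (hG.mono hFG) (fun I hI => hA I (hFG hI)) hf hg2
      rw [Finset.sum_map] at h1
      have h2 : ∀ I : G, (μ I)⁻¹ * ‖inner ℂ (∫ x in (I : Set X), V x (f x) ∂μ)
          (∫ x in (I : Set X), U x (g x) ∂μ)‖ₑ = μ Q * ‖inner ℂ e (a I)‖ₑ := by
        intro I
        rw [hgI I I.2, ha]
        simp only
        rw [setAverage_eq, ← Complex.coe_smul, inner_smul_right, inner_smul_right, ← ofReal_norm,
          ← ofReal_norm, norm_mul, norm_mul, Complex.norm_real, Complex.norm_real,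
          Real.norm_of_nonneg (by positivity), Real.norm_of_nonneg (by positivity),
          ENNReal.ofReal_mul (by positivity), ENNReal.ofReal_mul (by positivity),
          ofReal_measureReal_inv (hG.measure_ne_zero I I.2) (hG.measure_ne_top I I.2),
          ofReal_measureReal hQt, norm_inner_symm]
        ring
      simp only [Function.Embedding.subtype_apply, h2] at h1
      rw [← Finset.mul_sum, ← hM] at h1
      -- Since `h1` bounds a square, `t² ≤ M` is weakened to `t ≤ M + 1`, avoiding square roots.
      have h3 : μ Q * ∑ I ∈ F, ‖inner ℂ e (a I)‖ₑ ≤ M + 1 := by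
        by_contra! hlt
        have h1' : 1 ≤ μ Q * ∑ I ∈ F, ‖inner ℂ e (a I)‖ₑ := le_add_self.trans hlt.le
        refine absurd h1 (not_le.2 ?_)
        calc M ≤ M + 1 := le_self_add
          _ < _ := hlt
          _ ≤ _ := le_self_pow₀ h1' two_ne_zero
      have h4 : ∑ I ∈ F, ‖inner ℂ e (a I)‖ₑ ≤ (μ Q)⁻¹ * (M + 1) := by
        rw [mul_comm, ← div_eq_mul_inv, ENNReal.le_div_iff_mul_le (.inl hQ0) (.inl hQt), mul_comm]
        exact h3
      have h5 : ENNReal.ofReal (∑ I ∈ F, ‖inner ℂ e (a I)‖) ≤ (μ Q)⁻¹ * (M + 1) := by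
        rw [ENNReal.ofReal_sum_of_nonneg fun _ _ => norm_nonneg _]
        simpa only [ofReal_norm] using h4
      exact (ENNReal.ofReal_le_iff_le_toReal (ENNReal.mul_ne_top (ENNReal.inv_ne_top.2 hQ0)
        (ENNReal.add_ne_top.2 ⟨hMt.ne, ENNReal.one_ne_top⟩))).1 h5
    exact summable_of_sum_le (fun _ => norm_nonneg _) hbd
  have b := stdOrthonormalBasis ℂ H
  have hab : (fun I : G => a I) = fun I : G => ∑ i, inner ℂ (b i) (a I) • b i :=
    funext fun I => (b.sum_repr' (a I)).symm
  change Summable fun I : G => a I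
  rw [hab]
  refine summable_sum fun i _ => ?_
  exact ((hcoord (b i)).of_norm).smul_const (b i)

end IsInversePair

/-! ### Infinite sparse families -/

/-- Almost every point of `Q` lies in only finitely many members of the family contained in `Q`. -/
theorem IsNestedSparse.ae_finite_mem {X : Type*} [MeasurableSpace X] {μ : Measure X}
    {G : Set (Set X)} (hG : IsNestedSparse μ G) {Q : Set X} (hQ : μ Q ≠ ∞) :
    ∀ᵐ x ∂μ, {I : G | x ∈ (I : Set X) ∧ (I : Set X) ⊆ Q}.Finite := by
  set G' : Set (Set X) := {I | I ∈ G ∧ I ⊆ Q} with hG'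
  have hG'G : G' ⊆ G := fun _ hI => hI.1
  have hG's := hG.mono hG'G
  have : Countable G' := hG's.countable.to_subtype
  have hsum : ∑' I : G', μ (I : Set X) ≠ ∞ := by
    refine ne_top_of_le_ne_top (ENNReal.mul_ne_top ENNReal.ofNat_ne_top hQ : 2 * μ Q ≠ ∞) ?_
    calc ∑' I : G', μ (I : Set X) ≤ ∑' I : G', 2 * μ (exceptionalPart G' I) :=
          ENNReal.tsum_le_tsum fun I => hG's.le_two_mul I I.2
      _ = 2 * μ (⋃ I : G', exceptionalPart G' I) := by
          rw [ENNReal.tsum_mul_left, measure_iUnion]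
          · exact fun I J hIJ => disjoint_exceptionalPart I.2 J.2 (Subtype.coe_injective.ne hIJ)
              (hG's.nested I I.2 J J.2)
          · exact fun I => measurableSet_exceptionalPart hG's.countable hG's.measurableSet
              (hG's.measurableSet I I.2)
      _ ≤ 2 * μ Q := by
          gcongr
          exact Set.iUnion_subset fun I => (exceptionalPart_subset _ _).trans I.2.2
  -- Borel-Cantelli.
  filter_upwards [ae_finite_setOfPred_mem hsum] with x hx
  refine Set.Finite.of_finite_image (f := Subtype.val) ?_ Subtype.coe_injective.injOn
  refine (hx.image Subtype.val).subset ?_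
  rintro _ ⟨I, hI, rfl⟩
  exact ⟨⟨I, I.2, hI.2⟩, hI.1, rfl⟩

namespace IsInversePair

variable {X H : Type*} [MeasurableSpace X] [NormedAddCommGroup H] [InnerProductSpace ℂ H]
  [CompleteSpace H] {μ : Measure X} {U V : X → H →L[ℂ] H} [SFinite μ] [FiniteDimensional ℂ H]

/-- Almost everywhere absolute convergence of sparse sums. -/
theorem ae_summable_indicator_average (h : IsInversePair μ U V) {G : Set (Set X)}
    (hG : IsNestedSparse μ G) {A : ℝ≥0} (hA : ∀ I ∈ G, crossEnergy μ U V I ≤ A * μ I ^ 2)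
    {f : X → H} (hf : MemLp f 2 μ) {S : Set (Set X)} (hSc : S.Countable) (hSu : ⋃₀ S = Set.univ)
    (hSm : ∀ Q ∈ S, MeasurableSet Q) (hS0 : ∀ Q ∈ S, μ Q ≠ 0) (hSt : ∀ Q ∈ S, μ Q ≠ ∞)
    (hSV : ∀ Q ∈ S, MemLp V 2 (μ.restrict Q))
    (hSG : ∀ Q ∈ S, ∀ I ∈ G, Q ⊆ I ∨ I ⊆ Q ∨ Disjoint Q I) :
    ∀ᵐ x ∂μ, Summable fun I : G =>
      (I : Set X).indicator (fun _ => ⨍ y in (I : Set X), V y (f y) ∂μ) x := by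
  classical
  have hfin : ∀ᵐ x ∂μ, ∀ Q ∈ S, {I : G | x ∈ (I : Set X) ∧ (I : Set X) ⊆ Q}.Finite :=
    (ae_ball_iff hSc).2 fun Q hQ => hG.ae_finite_mem (hSt Q hQ)
  filter_upwards [hfin] with x hx
  obtain ⟨Q, hQ, hxQ⟩ : ∃ Q ∈ S, x ∈ Q := by
    simpa using (hSu ▸ Set.mem_univ x : x ∈ ⋃₀ S)
  set a : Set X → H := fun I => ⨍ y in I, V y (f y) ∂μ with ha
  set G' : Set (Set X) := {I | I ∈ G ∧ Q ⊆ I} with hG'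
  have hsum : Summable fun I : G' => a I :=
    h.summable_average_of_subset (hG.mono fun _ hI => hI.1) (fun I hI => hA I hI.1) hf
      (hSm Q hQ) (hS0 Q hQ) (hSt Q hQ) (hSV Q hQ) fun I hI => hI.2
  have hsum' : Summable fun I : G => if Q ⊆ I then a I else 0 := by
    let i : G' → G := fun I => ⟨I, I.2.1⟩
    have hi : Function.Injective i := fun I J hIJ =>
      Subtype.ext (congrArg (fun K : G => (K : Set X)) hIJ)
    refine (hi.summable_iff ?_).1 ?_
    · intro I hI
      rw [if_neg]
      exact fun hQI => hI ⟨⟨I, I.2, hQI⟩, rfl⟩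
    · refine hsum.congr fun I => ?_
      simp only [Function.comp, i]
      rw [if_pos I.2.2]
  -- At `x ∈ Q` the two series differ only at members inside `Q` containing `x`, and there are
  -- finitely many of these.
  refine (summable_congr_cofinite ?_).2 hsum'
  rw [Filter.EventuallyEq, Filter.eventually_cofinite]
  refine (hx Q hQ).subset fun I hI => ?_
  by_cases hQI : Q ⊆ I
  · exact absurd (by rw [if_pos hQI, Set.indicator_of_mem (hQI hxQ)]) hI
  · have hxI : x ∈ (I : Set X) := by
      by_contra hxI
      exact hI (by rw [if_neg hQI, Set.indicator_of_notMem hxI])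
    refine ⟨hxI, ?_⟩
    rcases hSG Q hQ I I.2 with h1 | h1 | h1
    · exact absurd h1 hQI
    · exact h1
    · exact absurd hxI (Set.disjoint_left.1 h1 hxQ)

/-- `L²` bound for almost everywhere convergent sparse sums. -/
theorem lintegral_enorm_tsum_indicator_sq_le (h : IsInversePair μ U V) {G : Set (Set X)}
    (hG : IsNestedSparse μ G) {A : ℝ≥0} (hA : ∀ I ∈ G, crossEnergy μ U V I ≤ A * μ I ^ 2)
    {f : X → H} (hf : MemLp f 2 μ)
    (hs : ∀ᵐ x ∂μ, Summable fun I : G =>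
      (I : Set X).indicator (fun _ => ⨍ y in (I : Set X), V y (f y) ∂μ) x) :
    AEStronglyMeasurable (fun x => ∑' I : G,
        (I : Set X).indicator (fun _ => ⨍ y in (I : Set X), V y (f y) ∂μ) x) μ ∧
      ∫⁻ x, ‖U x (∑' I : G,
        (I : Set X).indicator (fun _ => ⨍ y in (I : Set X), V y (f y) ∂μ) x)‖ₑ ^ 2 ∂μ
      ≤ 256 * A ^ 3 * ∫⁻ x, ‖f x‖ₑ ^ 2 ∂μ := by
  set b : G → X → H := fun I => (I : Set X).indicator fun _ => ⨍ y in (I : Set X), V y (f y) ∂μ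
    with hb
  have : Countable G := hG.countable.to_subtype
  obtain ⟨s, hst⟩ := Filter.exists_seq_tendsto (Filter.atTop : Filter (Finset G))
  have hbm : ∀ F : Finset G, AEStronglyMeasurable (fun x => ∑ I ∈ F, b I x) μ := fun F =>
    Finset.aestronglyMeasurable_fun_sum F fun I _ =>
      aestronglyMeasurable_const.indicator (hG.measurableSet I I.2)
  have hlim : ∀ᵐ x ∂μ, Filter.Tendsto (fun k => ∑ I ∈ s k, b I x) Filter.atTop
      (nhds (∑' I, b I x)) := hs.mono fun x hx => hx.hasSum.comp hst
  refine ⟨aestronglyMeasurable_of_tendsto_ae Filter.atTop (fun k => hbm (s k)) hlim, ?_⟩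
  have hfinite : ∀ F : Finset G, ∫⁻ x, ‖U x (∑ I ∈ F, b I x)‖ₑ ^ 2 ∂μ
      ≤ 256 * A ^ 3 * ∫⁻ x, ‖f x‖ₑ ^ 2 ∂μ := by
    intro F
    have hFG : ((F.map (Function.Embedding.subtype _) : Finset (Set X)) : Set (Set X)) ⊆ G := by
      intro I hI
      obtain ⟨J, -, rfl⟩ := Finset.mem_map.1 (Finset.mem_coe.1 hI)
      exact J.2
    have := h.lintegral_enorm_sum_indicator_sq_le (hG.mono hFG) (fun I hI => hA I (hFG hI)) hf
    simp only [Finset.sum_map] at this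
    exact this
  calc ∫⁻ x, ‖U x (∑' I, b I x)‖ₑ ^ 2 ∂μ
      = ∫⁻ x, Filter.liminf (fun k => ‖U x (∑ I ∈ s k, b I x)‖ₑ ^ 2) Filter.atTop ∂μ := by
        refine lintegral_congr_ae (hlim.mono fun x hx => ?_)
        have h1 := ((U x).continuous.tendsto _).comp hx
        have h2 := ((ENNReal.continuous_pow 2).tendsto _).comp h1.enorm
        exact h2.liminf_eq.symm
    -- Fatou along an exhausting sequence of finite subfamilies.
    _ ≤ Filter.liminf (fun k => ∫⁻ x, ‖U x (∑ I ∈ s k, b I x)‖ₑ ^ 2 ∂μ) Filter.atTop :=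
        lintegral_liminf_le' fun k => (h.aestronglyMeasurable_apply (hbm (s k))).enorm.pow_const 2
    _ ≤ _ := by
        refine Filter.liminf_le_of_le (by isBoundedDefault) fun c hc => ?_
        obtain ⟨k, hk⟩ := hc.exists
        exact hk.trans (hfinite _)

end IsInversePair

/-! ### Dyadic grids -/

section Grid

variable {d : ℕ}

theorem cube_eq_pi (a : Fin d → ℝ) (ℓ : ℝ) :
    cube a ℓ = Set.univ.pi fun i => Set.Ico (a i) (a i + ℓ) := by
  ext x
  simp [cube]

theorem measurableSet_cube (a : Fin d → ℝ) (ℓ : ℝ) : MeasurableSet (cube a ℓ) := by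
  rw [cube_eq_pi]
  exact MeasurableSet.univ_pi fun i => measurableSet_Ico

theorem volume_cube (a : Fin d → ℝ) (ℓ : ℝ) : volume (cube a ℓ) = ENNReal.ofReal ℓ ^ d := by
  rw [cube_eq_pi, Real.volume_pi_Ico]
  simp

theorem volume_cube_ne_zero (a : Fin d → ℝ) {ℓ : ℝ} (hℓ : 0 < ℓ) : volume (cube a ℓ) ≠ 0 := by
  rw [volume_cube]
  exact pow_ne_zero _ (by simpa using hℓ)

theorem volume_cube_ne_top (a : Fin d → ℝ) (ℓ : ℝ) : volume (cube a ℓ) ≠ ∞ := by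
  rw [volume_cube]
  exact ENNReal.pow_ne_top ENNReal.ofReal_ne_top

theorem le_of_cube_subset_cube (hd : 0 < d) {a b : Fin d → ℝ} {ℓ m : ℝ} (hm : 0 ≤ m)
    (h : cube a ℓ ⊆ cube b m) : ℓ ≤ m := by
  have := measure_mono (μ := volume) h
  rw [volume_cube, volume_cube, ENNReal.pow_le_pow_left_iff hd.ne'] at this
  exact (ENNReal.ofReal_le_ofReal_iff hm).1 this

variable {D G : Set (Set (Fin d → ℝ))}

namespace IsDyadicGrid

variable (hD : IsDyadicGrid D)
include hD

theorem measurableSet {I : Set (Fin d → ℝ)} (hI : I ∈ D) : MeasurableSet I := by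
  obtain ⟨k, a, rfl⟩ := hD.eq_cube I hI
  exact measurableSet_cube _ _

theorem volume_ne_zero {I : Set (Fin d → ℝ)} (hI : I ∈ D) : volume I ≠ 0 := by
  obtain ⟨k, a, rfl⟩ := hD.eq_cube I hI
  exact volume_cube_ne_zero _ (by positivity)

theorem volume_ne_top {I : Set (Fin d → ℝ)} (hI : I ∈ D) : volume I ≠ ∞ := by
  obtain ⟨k, a, rfl⟩ := hD.eq_cube I hI
  exact volume_cube_ne_top _ _

theorem countable : D.Countable := by
  have hk : ∀ k : ℤ, {I | I ∈ D ∧ ∃ a : Fin d → ℝ, I = cube a ((2 : ℝ) ^ k)}.Countable := by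
    intro k
    set Dk := {I | I ∈ D ∧ ∃ a : Fin d → ℝ, I = cube a ((2 : ℝ) ^ k)}
    have hc := Measure.countable_meas_pos_of_disjoint_iUnion (μ := (volume : Measure (Fin d → ℝ)))
      (As := fun I : Dk => (I : Set (Fin d → ℝ))) (fun I => hD.measurableSet I.2.1) (by
        intro I J hIJ
        refine Set.disjoint_left.2 fun x hxI hxJ => hIJ (Subtype.ext ?_)
        exact (hD.partition k x).unique ⟨I.2.1, hxI, I.2.2⟩ ⟨J.2.1, hxJ, J.2.2⟩)
    have hu : {I : Dk | 0 < volume (I : Set (Fin d → ℝ))} = Set.univ :=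
      Set.eq_univ_of_forall fun I => pos_iff_ne_zero.2 (hD.volume_ne_zero I.2.1)
    rw [hu, Set.countable_univ_iff] at hc
    exact Set.countable_coe_iff.1 hc
  refine (Set.countable_iUnion hk).mono fun I hI => ?_
  obtain ⟨k, a, ha⟩ := hD.eq_cube I hI
  exact Set.mem_iUnion.2 ⟨k, hI, a, ha⟩

/-- Members of `G` between `J` and `I` have side length at most that of `I`, so one with the
greatest exponent exists. It is maximal because grid cubes of equal side that meet coincide.
Positive dimension is what lets inclusion compare side lengths. -/
theorem exists_subset_childrenIn (hd : 0 < d) (hGD : G ⊆ D) {I J : Set (Fin d → ℝ)} (hI : I ∈ G)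
    (hJ : J ∈ G) (hJI : J ⊂ I) : ∃ K ∈ childrenIn G I, J ⊆ K := by
  obtain ⟨k₀, a₀, hI₀⟩ := hD.eq_cube I (hGD hI)
  obtain ⟨kJ, aJ, hJ₀⟩ := hD.eq_cube J (hGD hJ)
  obtain ⟨k, ⟨K, hKG, hJK, hKI, a, hK⟩, hmax⟩ := Int.exists_greatest_of_bdd
    (P := fun k => ∃ K ∈ G, J ⊆ K ∧ K ⊂ I ∧ ∃ a : Fin d → ℝ, K = cube a ((2 : ℝ) ^ k))
    ⟨k₀, by
      rintro k ⟨K, -, -, hKI, a, rfl⟩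
      rw [hI₀] at hKI
      exact (zpow_le_zpow_iff_right₀ (by norm_num : (1 : ℝ) < 2)).1
        (le_of_cube_subset_cube hd (by positivity) hKI.subset)⟩
    ⟨kJ, J, hJ, subset_rfl, hJI, aJ, hJ₀⟩
  refine ⟨K, ⟨⟨hKG, hKI⟩, fun L hL hKL => ?_⟩, hJK⟩
  obtain ⟨l, b, hLb⟩ := hD.eq_cube L (hGD hL.1)
  have hlk : l ≤ k := hmax l ⟨L, hL.1, hJK.trans hKL, hL.2, b, hLb⟩
  have hkl : k ≤ l := by
    rw [hK, hLb] at hKL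
    exact (zpow_le_zpow_iff_right₀ (by norm_num : (1 : ℝ) < 2)).1
      (le_of_cube_subset_cube hd (by positivity) hKL)
  obtain rfl : l = k := le_antisymm hlk hkl
  obtain ⟨x, hx⟩ := nonempty_of_measure_ne_zero (hD.volume_ne_zero (hGD hKG))
  exact ((hD.partition l x).unique ⟨hGD hL.1, hKL hx, b, hLb⟩ ⟨hGD hKG, hx, a, hK⟩).le

theorem isNestedSparse (hd : 0 < d) (hGD : G ⊆ D) (hG : IsSparse G) : IsNestedSparse volume G where
  countable := hD.countable.mono hGD
  measurableSet I hI := hD.measurableSet (hGD hI)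
  nested I hI J hJ := hD.nested I (hGD hI) J (hGD hJ)
  measure_ne_zero I hI := hD.volume_ne_zero (hGD hI)
  measure_ne_top I hI := hD.volume_ne_top (hGD hI)
  le_two_mul I hI := by
    set N := ⋃₀ {J | J ∈ G ∧ J ⊂ I} with hN
    have hcG : childrenIn G I ⊆ G := fun J hJ =>
      (show Maximal (fun K => K ∈ G ∧ K ⊂ I) J from hJ).prop.1
    have : Countable (childrenIn G I) := (hD.countable.mono (hcG.trans hGD)).to_subtype
    have hNle : volume N ≤ volume I / 2 := by
      refine le_trans ?_ (hG I hI)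
      refine (measure_mono ?_).trans (measure_iUnion_le _)
      rintro x ⟨J, ⟨hJ, hJI⟩, hx⟩
      obtain ⟨K, hK, hJK⟩ := hD.exists_subset_childrenIn hd hGD hI hJ hJI
      exact Set.mem_iUnion.2 ⟨⟨K, hK⟩, hJK hx⟩
    have hIt : volume I / 2 ≠ ∞ := ENNReal.div_ne_top (hD.volume_ne_top (hGD hI)) two_ne_zero
    have h1 : volume I / 2 ≤ volume (exceptionalPart G I) := by
      refine (ENNReal.add_le_add_iff_right hIt).1 ?_
      rw [ENNReal.add_halves]
      calc volume I ≤ volume ((I \ N) ∪ N) := measure_mono fun x hx => by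
            by_cases hxN : x ∈ N
            · exact Or.inr hxN
            · exact Or.inl ⟨hx, hxN⟩
        _ ≤ volume (I \ N) + volume N := measure_union_le _ _
        _ ≤ _ := by gcongr; exact le_rfl
    calc volume I = 2 * (volume I / 2) := (ENNReal.mul_div_cancel two_ne_zero (by norm_num)).symm
      _ ≤ _ := by gcongr

end IsDyadicGrid
end Grid

/-! ### Square roots of the matrix weight -/

section Weight

/-- Extending `φ` by zero off `s` gives a Borel function. This covers the square root on the closed
positive cone and inversion on the open set of units. -/
theorem ContinuousOn.comp_aestronglyMeasurable_of_ae_mem {X E E' : Type*} [MeasurableSpace X]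
    {μ : Measure X} [TopologicalSpace E] [TopologicalSpace.PseudoMetrizableSpace E]
    [TopologicalSpace E'] [TopologicalSpace.PseudoMetrizableSpace E'] [SecondCountableTopology E']
    [Zero E'] {φ : E → E'} {s : Set E} (hφ : ContinuousOn φ s)
    (hs : IsOpen s ∨ IsClosed s) {f : X → E} (hf : AEStronglyMeasurable f μ)
    (hfs : ∀ᵐ x ∂μ, f x ∈ s) : AEStronglyMeasurable (fun x => φ (f x)) μ := by
  classical
  borelize E
  borelize E'
  have hm : Measurable (s.piecewise φ fun _ => 0) :=
    hφ.measurable_piecewise continuousOn_const (hs.elim IsOpen.measurableSet IsClosed.measurableSet)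
  refine (hm.comp_aemeasurable hf.aemeasurable).aestronglyMeasurable.congr ?_
  exact hfs.mono fun x hx => by simp [hx]

variable {d n : ℕ} {W : (Fin d → ℝ) → Matrix (Fin n) (Fin n) ℂ}

/-- The operator `W(x)^{1/2}` on `ℂⁿ`. -/
noncomputable def weightSqrt (W : (Fin d → ℝ) → Matrix (Fin n) (Fin n) ℂ) (x : Fin d → ℝ) :
    EuclideanSpace ℂ (Fin n) →L[ℂ] EuclideanSpace ℂ (Fin n) :=
  Matrix.toEuclideanCLM (n := Fin n) (𝕜 := ℂ) (matrixSqrt (W x))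

/-- The operator `W(x)^{-1/2}` on `ℂⁿ`. -/
noncomputable def weightInvSqrt (W : (Fin d → ℝ) → Matrix (Fin n) (Fin n) ℂ) (x : Fin d → ℝ) :
    EuclideanSpace ℂ (Fin n) →L[ℂ] EuclideanSpace ℂ (Fin n) :=
  Matrix.toEuclideanCLM (n := Fin n) (𝕜 := ℂ) (matrixSqrt (W x))⁻¹

open scoped MatrixOrder Matrix.Norms.L2Operator in
theorem continuousOn_matrixSqrt :
    ContinuousOn (matrixSqrt (n := n)) {A | 0 ≤ A} :=
  CFC.continuousOn_sqrt

open scoped MatrixOrder Matrix.Norms.L2Operator in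
theorem isHermitian_matrixSqrt (A : Matrix (Fin n) (Fin n) ℂ) : (matrixSqrt A).IsHermitian :=
  (CFC.sqrt_nonneg A).isSelfAdjoint

open scoped MatrixOrder Matrix.Norms.L2Operator in
theorem isUnit_matrixSqrt {A : Matrix (Fin n) (Fin n) ℂ} (hA : A.PosDef) :
    IsUnit (matrixSqrt A) :=
  (CFC.isUnit_sqrt_iff A hA.posSemidef.nonneg).2 hA.isUnit

open scoped MatrixOrder Matrix.Norms.L2Operator in
theorem continuousOn_matrix_inv :
    ContinuousOn (fun A : Matrix (Fin n) (Fin n) ℂ => A⁻¹) {A | IsUnit A} := by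
  intro A hA
  simp only [Matrix.nonsing_inv_eq_ringInverse]
  obtain ⟨u, rfl⟩ := hA
  exact (NormedRing.inverse_continuousAt u).continuousWithinAt

theorem continuous_toEuclideanCLM :
    Continuous (Matrix.toEuclideanCLM (n := Fin n) (𝕜 := ℂ)) :=
  (Matrix.toEuclideanCLM (n := Fin n) (𝕜 := ℂ)).toAlgEquiv.toLinearMap.continuous_of_finiteDimensional

namespace IsA2Weight

theorem aestronglyMeasurable (hW : IsA2Weight W) : AEStronglyMeasurable W volume := by
  have : W = fun x => ∑ i, ∑ j, W x i j • Matrix.single i j (1 : ℂ) := by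
    funext x
    conv_lhs => rw [Matrix.matrix_eq_sum_single (W x)]
    simp
  rw [this]
  exact Finset.aestronglyMeasurable_fun_sum _ fun i _ =>
    Finset.aestronglyMeasurable_fun_sum _ fun j _ =>
      (hW.aemeasurable i j).aestronglyMeasurable.smul_const _

open scoped MatrixOrder Matrix.Norms.L2Operator in
theorem isInversePair (hW : IsA2Weight W) :
    IsInversePair volume (weightSqrt W) (weightInvSqrt W) := by
  have hs : AEStronglyMeasurable (fun x => matrixSqrt (W x)) volume :=
    continuousOn_matrixSqrt.comp_aestronglyMeasurable_of_ae_mem (.inr isClosed_Ici)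
      hW.aestronglyMeasurable (hW.posDef.mono fun x hx => hx.posSemidef.nonneg)
  have hu : ∀ᵐ x, IsUnit (matrixSqrt (W x)) := hW.posDef.mono fun x hx => isUnit_matrixSqrt hx
  have hi : AEStronglyMeasurable (fun x => (matrixSqrt (W x))⁻¹) volume :=
    continuousOn_matrix_inv.comp_aestronglyMeasurable_of_ae_mem (.inl Units.isOpen) hs hu
  refine ⟨continuous_toEuclideanCLM.comp_aestronglyMeasurable hs,
    continuous_toEuclideanCLM.comp_aestronglyMeasurable hi, ?_, ?_, ?_, ?_⟩
  · exact Filter.Eventually.of_forall fun x =>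
      IsSelfAdjoint.map (isHermitian_matrixSqrt (W x)) _
  · exact Filter.Eventually.of_forall fun x =>
      IsSelfAdjoint.map (isHermitian_matrixSqrt (W x)).inv _
  · filter_upwards [hu] with x hx
    rw [weightSqrt, weightInvSqrt, ← map_mul,
      Matrix.mul_nonsing_inv _ ((Matrix.isUnit_iff_isUnit_det _).1 hx), map_one]
  · filter_upwards [hu] with x hx
    rw [weightSqrt, weightInvSqrt, ← map_mul,
      Matrix.nonsing_inv_mul _ ((Matrix.isUnit_iff_isUnit_det _).1 hx), map_one]

end IsA2Weight

theorem crossEnergy_cube_le (W : (Fin d → ℝ) → Matrix (Fin n) (Fin n) ℂ) (a : Fin d → ℝ) {ℓ : ℝ}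
    (hℓ : 0 < ℓ) : crossEnergy volume (weightSqrt W) (weightInvSqrt W) (cube a ℓ)
      ≤ a2Char W * volume (cube a ℓ) ^ 2 := by
  have h0 := volume_cube_ne_zero a hℓ
  have ht := volume_cube_ne_top a ℓ
  have h : ⨍⁻ x in cube a ℓ, ⨍⁻ t in cube a ℓ,
      matrixOpNorm (matrixSqrt (W x) * (matrixSqrt (W t))⁻¹) ^ 2 ∂volume ∂volume ≤ a2Char W :=
    le_iSup_of_le a (le_iSup_of_le ℓ (le_iSup_of_le hℓ le_rfl))
  simp only [setLAverage_eq, div_eq_mul_inv] at h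
  rw [lintegral_mul_const' _ _ (ENNReal.inv_ne_top.2 h0), mul_assoc, ← sq] at h
  have h2 := mul_le_mul_left h (volume (cube a ℓ) ^ 2)
  rw [mul_assoc, ← mul_pow, ENNReal.inv_mul_cancel h0 ht, one_pow, mul_one] at h2
  refine le_trans (le_of_eq ?_) h2
  simp only [crossEnergy, weightSqrt, weightInvSqrt, matrixOpNorm, map_mul]

end Weight

/-! ### The sparse operator on `L²(W)` -/

section Sparse

variable {d n : ℕ} {D G : Set (Set (Fin d → ℝ))} {W : (Fin d → ℝ) → Matrix (Fin n) (Fin n) ℂ}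

theorem MemL2.memLp {f : (Fin d → ℝ) → EuclideanSpace ℂ (Fin n)} (hf : MemL2 W f)
    (hW : IsA2Weight W) : MemLp (fun x => weightSqrt W x (f x)) 2 volume := by
  refine ⟨hW.isInversePair.aestronglyMeasurable_apply hf.1, ?_⟩
  rw [eLpNorm_lt_top_iff_lintegral_rpow_enorm_lt_top (by norm_num) (by norm_num)]
  simp only [ENNReal.toReal_ofNat, ENNReal.rpow_ofNat]
  exact (ENNReal.rpow_lt_top_iff_of_pos (by norm_num)).1 hf.2

theorem IsDyadicGrid.crossEnergy_le (hD : IsDyadicGrid D) {I : Set (Fin d → ℝ)} (hI : I ∈ D) :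
    crossEnergy volume (weightSqrt W) (weightInvSqrt W) I ≤ a2Char W * volume I ^ 2 := by
  obtain ⟨k, a, rfl⟩ := hD.eq_cube I hI
  exact crossEnergy_cube_le W a (by positivity)

theorem IsDyadicGrid.memLp_weightInvSqrt (hD : IsDyadicGrid D) (hW : IsA2Weight W)
    {I : Set (Fin d → ℝ)} (hI : I ∈ D) : MemLp (weightInvSqrt W) 2 (volume.restrict I) := by
  refine hW.isInversePair.symm.memLp_restrict (hD.volume_ne_zero hI) ?_
  rw [hW.isInversePair.crossEnergy_comm]
  exact ((hD.crossEnergy_le hI).trans_lt (ENNReal.mul_lt_top hW.a2Char_lt_top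
    (ENNReal.pow_lt_top (hD.volume_ne_top hI).lt_top))).ne

theorem sparseOp_bound (hd : 0 < d) (hD : IsDyadicGrid D) (hGD : G ⊆ D) (hG : IsSparse G)
    (hW : IsA2Weight W) {f : (Fin d → ℝ) → EuclideanSpace ℂ (Fin n)} (hf : MemL2 W f) :
    (∀ I ∈ G, IntegrableOn f I volume) ∧
      (∀ᵐ x, Summable fun I : G =>
        (I : Set (Fin d → ℝ)).indicator (fun _ => ⨍ y in (I : Set (Fin d → ℝ)), f y) x) ∧
      AEStronglyMeasurable (sparseOp G f) volume ∧
      weightedNorm W (sparseOp G f) ≤ 16 * a2Char W ^ (3 / 2 : ℝ) * weightedNorm W f := by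
  have h := hW.isInversePair
  have hF := hf.memLp hW
  have hS := hD.isNestedSparse hd hGD hG
  have hVf : ∀ᵐ x, weightInvSqrt W x (weightSqrt W x (f x)) = f x := by
    filter_upwards [h.mul_right] with x hx
    change (weightInvSqrt W x * weightSqrt W x) (f x) = f x
    rw [hx]; rfl
  have havg : ∀ I : Set (Fin d → ℝ),
      ⨍ y in I, weightInvSqrt W y (weightSqrt W y (f y)) = ⨍ y in I, f y := fun I => by
    rw [setAverage_eq, setAverage_eq, integral_congr_ae (ae_restrict_of_ae hVf)]
  have hA : ∀ I ∈ G, crossEnergy volume (weightSqrt W) (weightInvSqrt W) I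
      ≤ (a2Char W).toNNReal * volume I ^ 2 := fun I hI => by
    rw [ENNReal.coe_toNNReal hW.a2Char_lt_top.ne]
    exact hD.crossEnergy_le (hGD hI)
  -- The countable cover consists of the grid cubes of side 1, which need not belong to `G`.
  have hsum := h.ae_summable_indicator_average hS hA hF
    (S := {Q | Q ∈ D ∧ ∃ a : Fin d → ℝ, Q = cube a ((2 : ℝ) ^ (0 : ℤ))})
    (hD.countable.mono fun Q hQ => hQ.1)
    (Set.eq_univ_of_forall fun x => by
      obtain ⟨Q, ⟨hQ, hxQ, ha⟩, -⟩ := hD.partition 0 x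
      exact ⟨Q, ⟨hQ, ha⟩, hxQ⟩)
    (fun Q hQ => hD.measurableSet hQ.1) (fun Q hQ => hD.volume_ne_zero hQ.1)
    (fun Q hQ => hD.volume_ne_top hQ.1) (fun Q hQ => hD.memLp_weightInvSqrt hW hQ.1)
    (fun Q hQ I hI => hD.nested Q hQ.1 I (hGD hI))
  obtain ⟨hm, hbound⟩ := h.lintegral_enorm_tsum_indicator_sq_le hS hA hF hsum
  simp only [havg] at hsum hm hbound
  refine ⟨fun I hI => ?_, hsum, hm, ?_⟩
  · exact (IsInversePair.integrable_apply (hD.memLp_weightInvSqrt hW (hGD hI))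
      (hF.restrict I)).congr (ae_restrict_of_ae hVf)
  · rw [ENNReal.coe_toNNReal hW.a2Char_lt_top.ne] at hbound
    calc weightedNorm W (sparseOp G f)
        ≤ (256 * a2Char W ^ 3 * ∫⁻ x, ‖weightSqrt W x (f x)‖ₑ ^ 2) ^ (1 / 2 : ℝ) :=
          ENNReal.rpow_le_rpow hbound (by norm_num)
      _ = (16 ^ 2 : ℝ≥0∞) ^ (1 / 2 : ℝ) * (a2Char W ^ 3) ^ (1 / 2 : ℝ) * weightedNorm W f := by
          rw [ENNReal.mul_rpow_of_nonneg _ _ (by norm_num),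
            ENNReal.mul_rpow_of_nonneg _ _ (by norm_num)]
          norm_num
          rfl
      _ = _ := by
          simp only [← ENNReal.rpow_natCast, ← ENNReal.rpow_mul]
          norm_num

end Sparse

theorem mainTheorem11 (d n : ℕ) (hd : 0 < d) (hn : 0 < n) :
    ∃ C : ℝ≥0, ∀ (D G : Set (Set (Fin d → ℝ))) (W : (Fin d → ℝ) → Matrix (Fin n) (Fin n) ℂ),
      IsDyadicGrid D → G ⊆ D → IsSparse G → IsA2Weight W →
        (∀ f : (Fin d → ℝ) → EuclideanSpace ℂ (Fin n), MemL2 W f →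
          (∀ I ∈ G, IntegrableOn f I volume) ∧
          (∀ᵐ x, Summable fun I : G =>
            (I : Set (Fin d → ℝ)).indicator (fun _ => ⨍ y in (I : Set (Fin d → ℝ)), f y) x) ∧
          MemL2 W (sparseOp G f)) ∧
        weightedOpNorm W (sparseOp (n := n) G) ≤ C * a2Char W ^ (3 / 2 : ℝ) := by
  refine ⟨16, fun D G W hD hGD hG hW => ⟨fun f hf => ?_, ?_⟩⟩
  · obtain ⟨h1, h2, h3, h4⟩ := sparseOp_bound hd hD hGD hG hW hf
    refine ⟨h1, h2, h3, h4.trans_lt (ENNReal.mul_lt_top (ENNReal.mul_lt_top (by norm_num) ?_) hf.2)⟩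
    exact ENNReal.rpow_lt_top_of_nonneg (by norm_num) hW.a2Char_lt_top.ne
  · exact sInf_le fun f hf => (sparseOp_bound hd hD hGD hG hW hf).2.2.2
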